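/- Let $X,Y$ be finite-dimensional Euclidean spaces, $A:X\to Y$ linear with adjoint $A^*$, $b\in Y$, $c\in X$, and let $K\subseteq Y$ be a closed convex cone with dual cone $K^*=\{y : \langle y,x\rangle\ge 0 \ \forall x\in K\}$. Assume that $K$ is nice, i.e. $K^*+E^\perp$ is closed for every face $E$ of $K$ ($E^\perp$ being the orthogonal complement of the linear span of $E$), and that the problem $$(P)\qquad \sup\{\langle c,x\rangle : b-Ax\in K\}$$ is feasible. The minimal cone $F_{\min}$ of $(P)$ is the unique face of $K$ that contains $b-Ax$ in its relative interior, where $x$ is a relative interior point of the feasible set of $(P)$ (the face does not depend on the choice of $x$). For a convex set $C$ and $x\in C$ put $\operatorname{dir}(x,C)=\{y : x+ty\in C\text{ for some }t>0\}$ and $\tan(x,C)=\operatorname{cl}\operatorname{dir}(x,C)\cap-\operatorname{cl}\operatorname{dir}(x,C)$. Let $L=\{y : A^*y=0,\ \langle b,y\rangle=0\}$ and $\ell=\min\{\ell_K-1,\dim L\}$, where $\ell_K$ is the number of members of a longest chain of nonempty faces of $K$. Consider the system in $(u_i,v_i)_{i=0}^{\ell+1}$ $$(EXT_{\rm nice,simple})\quad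 (u_0,v_0)=(0,0);\quad (u_i,v_i)\in K^*\times\tan(u_{i-1},K^*),\ i=1,\dots,\ell+1;\quad u_i+v_i\in L,\ i=1,\dots,\ell.$$ Say that a minimization problem has strong duality with a feasible maximization problem if the latter is bounded if and only if the former is feasible and, when this is the case, their optimal values agree and the optimal value of the minimization problem is attained. Then $$F_{\min}^*=\{u_{\ell+1}+v_{\ell+1} : (u_i,v_i)_{i=0}^{\ell+1}\text{ is feasible in }(EXT_{\rm nice,simple})\},$$ and the problem $$\inf\{\langle b,u_{\ell+1}+v_{\ell+1}\rangle : A^*(u_{\ell+1}+v_{\ell+1})=c,\ (u_i,v_i)_{i=0}^{\ell+1}\text{ is feasible in }(EXT_{\rm nice,simple})\}$$ has strong duality with $(P)$. In particular, let $a_1,\dots,a_m$ be linearly independent symmetric $n\times n$ real matrices, $b$ a symmetric $n\times n$ real matrix, $c\in\mathbb R^m$, and suppose that the semidefinite program $\sup\{\sum_k c_kx_k : b-\sum_k x_ka_k\succeq 0\}$ is feasible. Put $\ell=\min\{n,\ n(n+1)/2-m-1\}$ if $b\notin\operatorname{span}\{a_1,\dots,a_m\}$, and $\ell=\min\{n,\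 n(n+1)/2-m\}$ if $b\in\operatorname{span}\{a_1,\dots,a_m\}$. Then, with $\langle x,z\rangle=\sum_{i,j}x_{ij}z_{ij}$, the problem $$\begin{array}{rl}\inf & \langle b,u_{\ell+1}+v_{\ell+1}\rangle\\ \text{s.t.} & \langle a_k,u_{\ell+1}+v_{\ell+1}\rangle=c_k,\quad k=1,\dots,m,\\ & \langle a_k,u_i+v_i\rangle=0\ (k=1,\dots,m),\quad \langle b,u_i+v_i\rangle=0,\quad i=1,\dots,\ell,\\ & u_i\succeq0,\quad \begin{pmatrix}u_{i-1}&w_i\\ w_i^T&\beta_iI\end{pmatrix}\succeq0,\quad v_i=w_i+w_i^T,\quad i=1,\dots,\ell+1,\\ & w_i\in\mathbb R^{n\times n},\ \beta_i\in\mathbb R,\quad i=1,\dots,\ell+1,\qquad (u_0,v_0)=(0,0)\end{array}$$ has strong duality with this semidefinite program. -/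

import Mathlib

open scoped Pointwise

noncomputable section

namespace ExtendedDual

section General

variable {X Y : Type*}
  [NormedAddCommGroup X] [InnerProductSpace ℝ X] [FiniteDimensional ℝ X]
  [NormedAddCommGroup Y] [InnerProductSpace ℝ Y] [FiniteDimensional ℝ Y]

/-- `F` is a (nonempty) face of the convex set `C`: a convex subset of `C` such that whenever the
open segment between two points of `C` meets `F`, both points belong to `F`. -/
structure IsFace (F C : Set Y) : Prop where
  nonempty : F.Nonempty
  convex : Convex ℝ F
  extreme : IsExtreme ℝ C F

/-- Feasible directions at `x` in `C`. -/
def dir (x : Y) (C : Set Y) : Set Y :=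
  {y | ∃ t : ℝ, 0 < t ∧ x + t • y ∈ C}

/-- The tangent space at `x` in `C`: `cl dir(x, C) ∩ -cl dir(x, C)`. -/
def tan (x : Y) (C : Set Y) : Set Y :=
  closure (dir x C) ∩ -closure (dir x C)

/-- The orthogonal complement of the linear span of a set. -/
def perp (S : Set Y) : Submodule ℝ Y := (Submodule.span ℝ S)ᗮ

/-- The cone `K` is nice: `K^* + E^⊥` is closed for all faces `E` of `K`. -/
def IsNice (K : ProperCone ℝ Y) : Prop :=
  ∀ E : Set Y, IsFace E (K : Set Y) →
    IsClosed ((ProperCone.innerDual (K : Set Y) : Set Y) + (perp E : Set Y))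

/-- The feasible set `{x | b - A x ∈ K}` of the primal problem. -/
def feas (A : X →ₗ[ℝ] Y) (b : Y) (K : ProperCone ℝ Y) : Set X :=
  {x | b - A x ∈ K}

/-- `F` is the minimal cone of `A x ≤_K b`: a face of `K` which contains `b - A x` in its relative
interior, where `x` is a relative interior point of the feasible set. -/
def IsMinimalCone (A : X →ₗ[ℝ] Y) (b : Y) (K : ProperCone ℝ Y) (F : Set Y) : Prop :=
  IsFace F (K : Set Y) ∧
    ∃ x ∈ intrinsicInterior ℝ (feas A b K), b - A x ∈ intrinsicInterior ℝ F

/-- The null space of `(A, b)^* : y ↦ (A^* y, ⟨b, y⟩)`. -/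
def nullAdj (A : X →ₗ[ℝ] Y) (b : Y) : Submodule ℝ Y :=
  LinearMap.ker (LinearMap.adjoint A) ⊓ LinearMap.ker (innerₗ Y b)

/-- `ℓ_K`, the length (number of members) of the longest chain of faces of `K`. -/
def faceChainLength (K : ProperCone ℝ Y) : ℕ∞ :=
  {F : Set Y | IsFace F (K : Set Y)}.chainHeight (· ⊆ ·)

/-- `ℓ = min {ℓ_K - 1, dim L}` with `L` the null space of `(A, b)^*`. The minimum is finite since
`dim L` is, so `toNat` only changes its type. -/
def ell (A : X →ₗ[ℝ] Y) (b : Y) (K : ProperCone ℝ Y) : ℕ :=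
  (min (faceChainLength K - 1) (Module.finrank ℝ (nullAdj A b) : ℕ∞)).toNat

/-- Feasibility of `(u_i, v_i)`, `i = 0, …, ℓ + 1`, in the simplified extended system:
`(u_0, v_0) = (0, 0)`; `(u_i, v_i) ∈ K^* × tan(u_{i-1}, K^*)` for `i = 1, …, ℓ + 1`;
`u_i + v_i ∈ L` for `i = 1, …, ℓ`. -/
structure ExtNiceSimple (A : X →ₗ[ℝ] Y) (b : Y) (K : ProperCone ℝ Y) (l : ℕ)
    (u v : Fin (l + 2) → Y) : Prop where
  u_zero : u 0 = 0
  v_zero : v 0 = 0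
  u_mem : ∀ i : Fin (l + 1), u i.succ ∈ ProperCone.innerDual (K : Set Y)
  v_mem : ∀ i : Fin (l + 1), v i.succ ∈ tan (u i.castSucc) (ProperCone.innerDual (K : Set Y) : Set Y)
  add_mem : ∀ i : Fin l, u i.succ.castSucc + v i.succ.castSucc ∈ nullAdj A b

/-- Objective values `⟨c, x⟩` of the feasible solutions of the primal problem. -/
def primalValues (A : X →ₗ[ℝ] Y) (b : Y) (K : ProperCone ℝ Y) (c : X) : Set ℝ :=
  {r | ∃ x ∈ feas A b K, r = inner ℝ c x}

/-- Objective values `⟨b, u_{ℓ+1} + v_{ℓ+1}⟩` of the feasible solutions of the simplified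
extended dual. -/
def extDualValues (A : X →ₗ[ℝ] Y) (b : Y) (K : ProperCone ℝ Y) (c : X) (l : ℕ) : Set ℝ :=
  {r | ∃ u v : Fin (l + 2) → Y, ExtNiceSimple A b K l u v ∧
    LinearMap.adjoint A (u (Fin.last _) + v (Fin.last _)) = c ∧
    r = inner ℝ b (u (Fin.last _) + v (Fin.last _))}

end General

/-- Strong duality between a feasible maximization problem with set of objective values `P` and a
minimization problem with set of objective values `D`: the former is bounded iff the latter is
feasible, and in that case the optimal values agree and the latter is attained. -/
def StrongDuality (P D : Set ℝ) : Prop :=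
  (BddAbove P ↔ D.Nonempty) ∧
    (BddAbove P → ∃ p : ℝ, IsLUB P p ∧ IsLeast D p)

section SDP

variable {m n : ℕ}

/-- The inner product `∑ x_ij z_ij` of matrices. -/
def matInner (x z : Matrix (Fin n) (Fin n) ℝ) : ℝ := ∑ i, ∑ j, x i j * z i j

/-- The feasible set `{x | b - ∑ x_k a_k ⪰ 0}` of a semidefinite program. -/
def sdpFeas (a : Fin m → Matrix (Fin n) (Fin n) ℝ) (b : Matrix (Fin n) (Fin n) ℝ) :
    Set (Fin m → ℝ) :=
  {x | (b - ∑ k, x k • a k).PosSemidef}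

/-- Objective values `∑ c_k x_k` of the feasible solutions of the semidefinite program. -/
def sdpPrimalValues (a : Fin m → Matrix (Fin n) (Fin n) ℝ) (b : Matrix (Fin n) (Fin n) ℝ)
    (c : Fin m → ℝ) : Set ℝ :=
  {r | ∃ x ∈ sdpFeas a b, r = ∑ k, c k * x k}

/-- Feasibility in the simplified extended dual of a semidefinite program. The matrices `u_i, v_i`
have indices `i = 0, …, ℓ + 1`; `w i` and `β i` stand for `w_{i+1}` and `β_{i+1}`. -/
structure SdpExtDual (a : Fin m → Matrix (Fin n) (Fin n) ℝ) (b : Matrix (Fin n) (Fin n) ℝ)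
    (c : Fin m → ℝ) (l : ℕ) (u v : Fin (l + 2) → Matrix (Fin n) (Fin n) ℝ)
    (w : Fin (l + 1) → Matrix (Fin n) (Fin n) ℝ) (β : Fin (l + 1) → ℝ) : Prop where
  adj_eq : ∀ k, matInner (a k) (u (Fin.last _) + v (Fin.last _)) = c k
  adj_zero : ∀ i : Fin l, ∀ k, matInner (a k) (u i.succ.castSucc + v i.succ.castSucc) = 0
  inner_zero : ∀ i : Fin l, matInner b (u i.succ.castSucc + v i.succ.castSucc) = 0
  u_psd : ∀ i : Fin (l + 1), (u i.succ).PosSemidef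
  block_psd : ∀ i : Fin (l + 1),
    (Matrix.fromBlocks (u i.castSucc) (w i) (w i).transpose
      (β i • (1 : Matrix (Fin n) (Fin n) ℝ))).PosSemidef
  v_eq : ∀ i : Fin (l + 1), v i.succ = w i + (w i).transpose
  u_zero : u 0 = 0
  v_zero : v 0 = 0

/-- Objective values `⟨b, u_{ℓ+1} + v_{ℓ+1}⟩` of the feasible solutions of the simplified extended
dual of a semidefinite program. -/
def sdpExtDualValues (a : Fin m → Matrix (Fin n) (Fin n) ℝ) (b : Matrix (Fin n) (Fin n) ℝ)
    (c : Fin m → ℝ) (l : ℕ) : Set ℝ :=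
  {r | ∃ u v w β, SdpExtDual a b c l u v w β ∧
    r = matInner b (u (Fin.last _) + v (Fin.last _))}

end SDP

end ExtendedDual

end

/-! The engine is facial reduction. Let `F` be the minimal cone. Some slack lies in its relative
interior, so over `F` a Slater condition holds and conic duality with `F*` in place of `K*` has no
gap and an attained dual (`IsMinimalCone.exists_dual_solution`). It remains to describe `F*`
(`IsMinimalCone.innerDual_eq`).

For `u ∈ K*` the tangent space of `K*` at `u` is the orthogonal complement of the face `K ∩ u^⊥`
(`mem_tan_innerDual`). In a feasible system, induction on `i` shows that each `u_i` with `i ≤ ℓ`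
vanishes on `F`; hence `v_{ℓ+1} ∈ F^⊥` and `u_{ℓ+1} + v_{ℓ+1} ∈ F*`. Conversely, start from the face
`G = K`. As long as `G ≠ F`, a theorem of the alternative gives `y ∈ L ∩ G*` that does not vanish on
`G`. Niceness splits it as `y = u + v` with `u ∈ K*` and `v ∈ G^⊥`, and `G ∩ u^⊥` is a strictly
smaller face that still contains `F`. Summing the `u`'s exposes each face by a single vector. Every
step lengthens a chain of faces and enlarges `L ∩ G^⊥`, which bounds the number of steps by `ℓ`.
Once `G = F`, niceness splits any element of `F*` into the final pair.

For semidefinite programs, a face of the cone is determined by the span of the vectors `z` with `z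
zᵀ` in it. This gives niceness and `ℓ_K ≤ n + 1`, and the block matrix constraint represents the
tangent space (`mem_perp_exposedFace_psdCone`). Upper bounds on `ℓ_K - 1` and `dim L` suffice, since
the general duality holds for every length at least their minimum. -/

noncomputable section

set_option linter.unusedSectionVars false

namespace ExtendedDual

/-! ### Relative interiors of convex sets -/

section Convexity

variable {Y : Type*} [NormedAddCommGroup Y] [InnerProductSpace ℝ Y]

/-- Segments ending at a relative interior point can be prolonged beyond it. -/
theorem exists_prolong_of_mem_intrinsicInterior {C : Set Y} {x y : Y}
    (hx : x ∈ intrinsicInterior ℝ C) (hy : y ∈ C) :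
    ∃ t : ℝ, 0 < t ∧ x + t • (x - y) ∈ C := by
  obtain ⟨x', hx', rfl⟩ := mem_intrinsicInterior.1 hx
  have hmem : ∀ t : ℝ, AffineMap.lineMap (x' : Y) y (-t) ∈ affineSpan ℝ C := fun t =>
    AffineMap.lineMap_mem _ x'.2 (subset_affineSpan ℝ C hy)
  let γ : ℝ → affineSpan ℝ C := fun t => ⟨AffineMap.lineMap (x' : Y) y (-t), hmem t⟩
  have hγ : Continuous γ := by
    refine Continuous.subtype_mk ?_ _
    exact (AffineMap.lineMap_continuous (R := ℝ)).comp continuous_neg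
  have h0 : γ 0 = x' := by
    apply Subtype.ext
    simp [γ]
  have hnhds : ∀ᶠ t in nhds (0 : ℝ), γ t ∈ interior ((↑) ⁻¹' C : Set (affineSpan ℝ C)) := by
    refine hγ.continuousAt.eventually_mem ?_
    rw [h0]
    exact isOpen_interior.mem_nhds hx'
  obtain ⟨ε, hε, h⟩ := Metric.eventually_nhds_iff.1 hnhds
  have hmem' : γ (ε / 2) ∈ interior ((↑) ⁻¹' C : Set (affineSpan ℝ C)) := by
    apply h
    rw [Real.dist_eq, sub_zero, abs_of_pos (by positivity)]
    linarith
  refine ⟨ε / 2, by positivity, ?_⟩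
  have h' : (γ (ε / 2) : Y) ∈ C := interior_subset (s := ((↑) ⁻¹' C : Set (affineSpan ℝ C))) hmem'
  have e : (γ (ε / 2) : Y) = (x' : Y) + (ε / 2) • ((x' : Y) - y) := by
    simp only [γ, AffineMap.lineMap_apply, vsub_eq_sub, vadd_eq_add]
    module
  rwa [e] at h'

/-- An open segment from a relative interior point stays in the relative interior. -/
theorem mem_intrinsicInterior_of_mem_openSegment {C : Set Y} (hC : Convex ℝ C) {x y z : Y}
    (hy : y ∈ intrinsicInterior ℝ C) (hz : z ∈ C) (hx : x ∈ openSegment ℝ z y) :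
    x ∈ intrinsicInterior ℝ C := by
  obtain ⟨y', hy', rfl⟩ := mem_intrinsicInterior.1 hy
  rw [openSegment_eq_image_lineMap] at hx
  obtain ⟨a, ⟨ha0, ha1⟩, rfl⟩ := hx
  have hz' := subset_affineSpan ℝ C hz
  -- The dilation with centre `z` and ratio `a⁻¹` sends the point in question to `y'`. Pulling back
  -- a neighbourhood of `y'` gives a neighbourhood inside `C`, because dilating back by `a` stays in
  -- `C`.
  let g : affineSpan ℝ C → affineSpan ℝ C := fun w =>
    ⟨AffineMap.lineMap z (w : Y) a⁻¹, AffineMap.lineMap_mem _ hz' w.2⟩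
  have hg : Continuous g := by
    refine Continuous.subtype_mk ?_ _
    simp only [AffineMap.lineMap_apply, vsub_eq_sub, vadd_eq_add]
    fun_prop
  refine mem_intrinsicInterior.2
    ⟨⟨AffineMap.lineMap z (y' : Y) a, AffineMap.lineMap_mem _ hz' y'.2⟩, ?_, rfl⟩
  rw [mem_interior]
  refine ⟨g ⁻¹' interior ((↑) ⁻¹' C), ?_, isOpen_interior.preimage hg, ?_⟩
  · intro w hw
    have h1 : (g w : Y) ∈ C := interior_subset (s := ((↑) ⁻¹' C : Set (affineSpan ℝ C))) hw
    have h2 : AffineMap.lineMap z (g w : Y) a ∈ C := hC.lineMap_mem hz h1 ⟨ha0.le, ha1.le⟩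
    have e : AffineMap.lineMap z (g w : Y) a = (w : Y) := by
      simp only [g, AffineMap.lineMap_apply, vsub_eq_sub, vadd_eq_add, add_sub_cancel_right,
        smul_smul, mul_inv_cancel₀ ha0.ne', one_smul, sub_add_cancel]
    rwa [e] at h2
  · have e : g ⟨AffineMap.lineMap z (y' : Y) a, AffineMap.lineMap_mem _ hz' y'.2⟩ = y' := by
      apply Subtype.ext
      simp only [g, AffineMap.lineMap_apply, vsub_eq_sub, vadd_eq_add, add_sub_cancel_right,
        smul_smul, inv_mul_cancel₀ ha0.ne', one_smul, sub_add_cancel]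
    rw [Set.mem_preimage, e]
    exact hy'

/-- A point beyond which all segments in a convex set can be prolonged is a relative interior
point. -/
theorem mem_intrinsicInterior_of_forall_prolong [FiniteDimensional ℝ Y] {C : Set Y}
    (hC : Convex ℝ C) {x : Y} (hx : x ∈ C)
    (h : ∀ y ∈ C, ∃ t : ℝ, 0 < t ∧ x + t • (x - y) ∈ C) : x ∈ intrinsicInterior ℝ C := by
  -- Prolonging a segment from some relative interior point `y` through `x` puts `x` strictly
  -- between `y` and a point of `C`.
  obtain ⟨y, hy⟩ := Set.Nonempty.intrinsicInterior hC ⟨x, hx⟩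
  obtain ⟨t, ht, hz⟩ := h y (intrinsicInterior_subset hy)
  refine mem_intrinsicInterior_of_mem_openSegment hC hy hz
    ⟨1 / (1 + t), t / (1 + t), by positivity, by positivity, by field_simp, ?_⟩
  have h1 : (1 + t) ≠ 0 := by positivity
  match_scalars <;> (field_simp; try ring)

end Convexity

/-! ### Faces of closed convex cones -/

section Faces

variable {Y : Type*} [NormedAddCommGroup Y] [InnerProductSpace ℝ Y]
  {K : ProperCone ℝ Y} {F G : Set Y}

theorem IsFace.subset (hF : IsFace F (K : Set Y)) : F ⊆ K := hF.extreme.subset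

theorem IsFace.zero_mem (hF : IsFace F (K : Set Y)) : (0 : Y) ∈ F := by
  obtain ⟨x, hx⟩ := hF.nonempty
  refine hF.extreme.left_mem_of_mem_openSegment (y := (2 : ℝ) • x) (ZeroMemClass.zero_mem K)
    (K.smul_mem (hF.subset hx) (by norm_num)) hx
    ⟨1 / 2, 1 / 2, by norm_num, by norm_num, by norm_num, ?_⟩
  module

theorem IsFace.smul_mem (hF : IsFace F (K : Set Y)) {x : Y} (hx : x ∈ F) {t : ℝ} (ht : 0 ≤ t) :
    t • x ∈ F := by
  rcases le_or_gt t 1 with h | h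
  · have := hF.convex hF.zero_mem hx (sub_nonneg.2 h) ht (by ring)
    simpa using this
  · refine hF.extreme.left_mem_of_mem_openSegment (y := 0) (K.smul_mem (hF.subset hx) ht)
      (ZeroMemClass.zero_mem K) hx ⟨t⁻¹, 1 - t⁻¹, by positivity, ?_, by ring, ?_⟩
    · exact sub_pos.2 (inv_lt_one_of_one_lt₀ h)
    · rw [smul_zero, add_zero, smul_smul, inv_mul_cancel₀ (by positivity), one_smul]

theorem IsFace.add_mem (hF : IsFace F (K : Set Y)) {x y : Y} (hx : x ∈ F) (hy : y ∈ F) :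
    x + y ∈ F := by
  have h := hF.smul_mem (hF.convex hx hy (a := 1 / 2) (b := 1 / 2) (by norm_num) (by norm_num)
    (by norm_num)) (t := 2) (by norm_num)
  convert h using 1
  module

/-- The sum is the midpoint of `2x` and `2y`. This additive form of extremality is the one used from
here on. -/
theorem IsFace.left_mem_of_add_mem (hF : IsFace F (K : Set Y)) {x y : Y} (hx : x ∈ K)
    (hy : y ∈ K) (h : x + y ∈ F) : x ∈ F := by
  have h2 : (2 : ℝ) • x ∈ F :=
    hF.extreme.left_mem_of_mem_openSegment (K.smul_mem hx (by norm_num) : (2 : ℝ) • x ∈ K)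
      (K.smul_mem hy (by norm_num) : (2 : ℝ) • y ∈ K) h
      ⟨1 / 2, 1 / 2, by norm_num, by norm_num, by norm_num, by module⟩
  have h3 := hF.smul_mem h2 (t := 1 / 2) (by norm_num)
  rwa [smul_smul, show (1 / 2 : ℝ) * 2 = 1 by norm_num, one_smul] at h3

theorem IsFace.mem_of_smul_mem (hF : IsFace F (K : Set Y)) {x : Y} {t : ℝ} (ht : 0 < t)
    (h : t • x ∈ F) : x ∈ F := by
  have h3 := hF.smul_mem h (t := t⁻¹) (by positivity)
  rwa [smul_smul, inv_mul_cancel₀ ht.ne', one_smul] at h3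

/-- Criterion for a subset of a cone to be a face. -/
theorem isFace_of_add (h0 : (0 : Y) ∈ F) (hK : F ⊆ K)
    (hadd : ∀ x ∈ F, ∀ y ∈ F, x + y ∈ F) (hsmul : ∀ t : ℝ, 0 ≤ t → ∀ x ∈ F, t • x ∈ F)
    (hext : ∀ x ∈ K, ∀ y ∈ K, x + y ∈ F → x ∈ F) : IsFace F (K : Set Y) where
  nonempty := ⟨0, h0⟩
  convex := fun x hx y hy a b ha hb _ => hadd _ (hsmul a ha x hx) _ (hsmul b hb y hy)
  extreme := by
    refine ⟨hK, ?_⟩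
    rintro x hx y hy z hz ⟨a, b, ha, hb, -, rfl⟩
    have h1 := hext _ (K.smul_mem hx ha.le) _ (K.smul_mem hy hb.le) hz
    have h2 := hsmul a⁻¹ (by positivity) _ h1
    rwa [smul_smul, inv_mul_cancel₀ ha.ne', one_smul] at h2

/-- The face of the cone `K` exposed by a vector `u` of the dual cone. -/
def exposedFace (K : ProperCone ℝ Y) (u : Y) : Set Y := {x | x ∈ K ∧ inner ℝ x u = 0}

theorem exposedFace_zero (K : ProperCone ℝ Y) : exposedFace K 0 = (K : Set Y) := by
  ext x
  simp [exposedFace]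

/-- The linear span of a face consists of differences of its elements. -/
theorem IsFace.exists_sub_of_mem_span (hF : IsFace F (K : Set Y)) {y : Y}
    (hy : y ∈ Submodule.span ℝ F) : ∃ g ∈ F, ∃ g' ∈ F, g - g' = y := by
  induction hy using Submodule.span_induction with
  | mem x hx => exact ⟨x, hx, 0, hF.zero_mem, sub_zero x⟩
  | zero => exact ⟨0, hF.zero_mem, 0, hF.zero_mem, sub_zero 0⟩
  | add x z _ _ hx hz =>
    obtain ⟨g, hg, g', hg', rfl⟩ := hx
    obtain ⟨h, hh, h', hh', rfl⟩ := hz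
    exact ⟨g + h, hF.add_mem hg hh, g' + h', hF.add_mem hg' hh', by abel⟩
  | smul a x _ hx =>
    obtain ⟨g, hg, g', hg', rfl⟩ := hx
    rcases le_total 0 a with ha | ha
    · exact ⟨a • g, hF.smul_mem hg ha, a • g', hF.smul_mem hg' ha, by rw [smul_sub]⟩
    · refine ⟨(-a) • g', hF.smul_mem hg' (neg_nonneg.2 ha), (-a) • g,
        hF.smul_mem hg (neg_nonneg.2 ha), by module⟩

/-- A face of a cone contains the points of the cone in its linear span. -/
theorem IsFace.mem_of_mem_span (hF : IsFace F (K : Set Y)) {y : Y} (hyK : y ∈ K)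
    (hy : y ∈ Submodule.span ℝ F) : y ∈ F := by
  obtain ⟨g, hg, g', hg', rfl⟩ := hF.exists_sub_of_mem_span hy
  exact hF.left_mem_of_add_mem hyK (hF.subset hg') (by rwa [sub_add_cancel])

/-- Every element of a face is dominated by a multiple of any relative interior point. -/
theorem IsFace.exists_smul_sub_mem (hF : IsFace F (K : Set Y)) {f : Y}
    (hf : f ∈ intrinsicInterior ℝ F) {g : Y} (hg : g ∈ F) : ∃ t : ℝ, 0 ≤ t ∧ t • f - g ∈ F := by
  obtain ⟨t, ht, h⟩ := exists_prolong_of_mem_intrinsicInterior hf hg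
  refine ⟨t⁻¹ * (1 + t), by positivity, ?_⟩
  have h2 := hF.smul_mem h (t := t⁻¹) (by positivity)
  convert h2 using 1
  match_scalars <;> field_simp

/-- A relative interior point is an order unit for the span of the face; this supplies the
absorption hypothesis of the Riesz extension theorem. -/
theorem IsFace.exists_smul_add_mem_of_mem_span (hF : IsFace F (K : Set Y)) {f : Y}
    (hf : f ∈ intrinsicInterior ℝ F) {y : Y} (hy : y ∈ Submodule.span ℝ F) :
    ∃ t : ℝ, 0 ≤ t ∧ t • f + y ∈ F := by
  obtain ⟨g, hg, g', hg', rfl⟩ := hF.exists_sub_of_mem_span hy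
  obtain ⟨t, ht, h⟩ := hF.exists_smul_sub_mem hf hg'
  refine ⟨t, ht, ?_⟩
  convert hF.add_mem h hg using 1
  abel

/-- A face meeting the relative interior of another face contains it. -/
theorem IsFace.subset_of_mem (hF : IsFace F (K : Set Y)) (hG : IsFace G (K : Set Y)) {f : Y}
    (hf : f ∈ intrinsicInterior ℝ F) (hfG : f ∈ G) : F ⊆ G := by
  intro g hg
  obtain ⟨t, ht, h⟩ := hF.exists_smul_sub_mem hf hg
  refine hG.left_mem_of_add_mem (hF.subset hg) (hF.subset h) ?_
  rw [add_sub_cancel]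
  exact hG.smul_mem hfG ht

variable [FiniteDimensional ℝ Y]

theorem isFace_exposedFace {u : Y} (hu : u ∈ ProperCone.innerDual (K : Set Y)) :
    IsFace (exposedFace K u) (K : Set Y) := by
  refine isFace_of_add ⟨ZeroMemClass.zero_mem K, by simp⟩ (fun x hx => hx.1) ?_ ?_ ?_
  · exact fun x hx y hy => ⟨add_mem hx.1 hy.1, by rw [inner_add_left, hx.2, hy.2, add_zero]⟩
  · exact fun t ht x hx => ⟨K.smul_mem hx.1 ht, by rw [real_inner_smul_left, hx.2, mul_zero]⟩
  · intro x hx y hy h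
    have h1 := h.2
    have h2 := ProperCone.mem_innerDual.1 hu hx
    have h3 := ProperCone.mem_innerDual.1 hu hy
    rw [inner_add_left] at h1
    exact ⟨hx, by linarith⟩

theorem exposedFace_add {u u' : Y} (hu : u ∈ ProperCone.innerDual (K : Set Y))
    (hu' : u' ∈ ProperCone.innerDual (K : Set Y)) :
    exposedFace K (u + u') = exposedFace K u ∩ exposedFace K u' := by
  ext x
  constructor
  · rintro ⟨hx, h⟩
    have h2 := ProperCone.mem_innerDual.1 hu hx
    have h3 := ProperCone.mem_innerDual.1 hu' hx
    rw [inner_add_right] at h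
    exact ⟨⟨hx, by linarith⟩, hx, by linarith⟩
  · rintro ⟨⟨hx, h⟩, -, h'⟩
    exact ⟨hx, by rw [inner_add_right, h, h', add_zero]⟩

/-- Every point of a closed convex cone lies in the relative interior of some face. -/
theorem exists_isFace_mem_intrinsicInterior {s : Y} (hs : s ∈ K) :
    ∃ F, IsFace F (K : Set Y) ∧ s ∈ intrinsicInterior ℝ F := by
  -- The smallest face through `s` consists of the points dominated, in the order of `K`, by a
  -- multiple of `s`.
  let F : Set Y := {y | y ∈ K ∧ ∃ t : ℝ, 0 ≤ t ∧ t • s - y ∈ K}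
  have hF : IsFace F (K : Set Y) := by
    refine isFace_of_add ⟨ZeroMemClass.zero_mem K, 0, le_rfl, by simp [ZeroMemClass.zero_mem]⟩
      (fun x hx => hx.1) ?_ ?_ ?_
    · rintro x ⟨hx, t, ht, h⟩ y ⟨hy, t', ht', h'⟩
      refine ⟨add_mem hx hy, t + t', by positivity, ?_⟩
      convert add_mem h h' using 1
      module
    · rintro c hc x ⟨hx, t, ht, h⟩
      refine ⟨K.smul_mem hx hc, c * t, by positivity, ?_⟩
      convert K.smul_mem h hc using 1
      module
    · rintro x hx y hy ⟨-, t, ht, h⟩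
      refine ⟨hx, t, ht, ?_⟩
      convert add_mem h hy using 1
      module
  have hsF : s ∈ F := ⟨hs, 1, by norm_num, by simp [ZeroMemClass.zero_mem]⟩
  refine ⟨F, hF, mem_intrinsicInterior_of_forall_prolong hF.convex hsF ?_⟩
  rintro y ⟨hy, t, ht, h⟩
  refine ⟨(t + 1)⁻¹, by positivity, ?_⟩
  have e : s + (t + 1)⁻¹ • (s - y) = (t + 1)⁻¹ • ((t • s - y) + (2 : ℝ) • s) := by
    match_scalars <;> field_simp
    ring
  have hpos : 0 ≤ (t + 1)⁻¹ := by positivity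
  refine ⟨?_, 1 + (t + 1)⁻¹, by positivity, ?_⟩
  · rw [e]
    exact K.smul_mem (add_mem h (K.smul_mem hs (by norm_num : (0 : ℝ) ≤ 2))) hpos
  · convert K.smul_mem hy hpos using 1
    module

end Faces

/-! ### Bipolarity, tangent spaces of dual cones, and niceness -/

section Duality

variable {Y : Type*} [NormedAddCommGroup Y] [InnerProductSpace ℝ Y] [FiniteDimensional ℝ Y]
  {K : ProperCone ℝ Y} {F G : Set Y}

/-- Bipolar theorem for pointed cones that need not be closed. -/
theorem mem_closure_of_forall_inner_nonneg (D : PointedCone ℝ Y) {y : Y}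
    (h : ∀ x, (∀ d ∈ D, 0 ≤ inner ℝ d x) → 0 ≤ inner ℝ y x) : y ∈ closure (D : Set Y) := by
  by_contra hy
  let C : ProperCone ℝ Y := Submodule.closure D
  have hC : (C : Set Y) = closure (D : Set Y) := rfl
  have hy' : y ∉ C := by
    rw [← SetLike.mem_coe, hC]
    exact hy
  obtain ⟨x, hx, hyx⟩ := C.hyperplane_separation' hy'
  refine absurd (h x fun d hd => hx d ?_) hyx.not_ge
  rw [← SetLike.mem_coe, hC]
  exact subset_closure hd

/-- The sum of a closed convex cone and a linear subspace. -/
def coneAddSubspace (C : ProperCone ℝ Y) (W : Submodule ℝ Y) : PointedCone ℝ Y :=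
  C.toSubmodule ⊔ PointedCone.ofSubmodule W

theorem coe_coneAddSubspace (C : ProperCone ℝ Y) (W : Submodule ℝ Y) :
    (coneAddSubspace C W : Set Y) = (C : Set Y) + (W : Set Y) :=
  Submodule.coe_sup _ _

theorem mem_perp {S : Set Y} {y : Y} : y ∈ perp S ↔ ∀ x ∈ S, inner ℝ x y = 0 := by
  rw [perp, Submodule.mem_orthogonal]
  refine ⟨fun h x hx => h x (Submodule.subset_span hx), fun h x hx => ?_⟩
  induction hx using Submodule.span_induction with
  | mem x hx => exact h x hx
  | zero => simp
  | add x z _ _ hx hz => rw [inner_add_left, hx, hz, add_zero]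
  | smul a x _ hx => rw [real_inner_smul_left, hx, mul_zero]

theorem perp_anti {S T : Set Y} (h : S ⊆ T) : perp T ≤ perp S := fun _ hy =>
  mem_perp.2 fun x hx => mem_perp.1 hy x (h hx)

theorem mem_of_forall_innerDual {x : Y}
    (h : ∀ d ∈ ProperCone.innerDual (K : Set Y), 0 ≤ inner ℝ d x) : x ∈ K := by
  rw [← ProperCone.innerDual_innerDual K]
  exact ProperCone.mem_innerDual.2 fun d hd => h d hd

/-- The feasible directions at `u` form `K* + ℝu`, whose dual is `K ∩ u^⊥`; the bipolar theorem then
computes their closure. -/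
theorem dir_innerDual {u : Y} (hu : u ∈ ProperCone.innerDual (K : Set Y)) :
    dir u (ProperCone.innerDual (K : Set Y) : Set Y) =
      (coneAddSubspace (ProperCone.innerDual (K : Set Y)) (Submodule.span ℝ {u}) : Set Y) := by
  rw [coe_coneAddSubspace]
  ext y
  constructor
  · rintro ⟨t, ht, h⟩
    refine ⟨t⁻¹ • (u + t • y), (ProperCone.innerDual (K : Set Y)).smul_mem h (by positivity),
      (-t⁻¹) • u, Submodule.smul_mem _ _ (Submodule.mem_span_singleton_self u), ?_⟩
    simp only
    match_scalars <;> field_simp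
    ring
  · rintro ⟨d, hd, _, hw, rfl⟩
    obtain ⟨r, rfl⟩ := Submodule.mem_span_singleton.1 hw
    -- The step length `(1 + |r|)⁻¹` keeps the total coefficient of `u` nonnegative even when `r <
    -- 0`.
    have hr : 0 < 1 + |r| := by positivity
    refine ⟨(1 + |r|)⁻¹, by positivity, ?_⟩
    have e : u + (1 + |r|)⁻¹ • (d + r • u) = (1 + |r|)⁻¹ • (d + (1 + |r| + r) • u) := by
      match_scalars <;> field_simp
    simp only
    rw [e]
    refine (ProperCone.innerDual (K : Set Y)).smul_mem (add_mem hd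
      ((ProperCone.innerDual (K : Set Y)).smul_mem hu ?_)) (by positivity)
    linarith [neg_abs_le r]

theorem mem_closure_dir_innerDual {u : Y} (hu : u ∈ ProperCone.innerDual (K : Set Y)) {y : Y} :
    y ∈ closure (dir u (ProperCone.innerDual (K : Set Y) : Set Y)) ↔
      ∀ x ∈ exposedFace K u, 0 ≤ inner ℝ x y := by
  constructor
  · intro hy x hx
    have hcl : IsClosed {y : Y | 0 ≤ inner ℝ x y} :=
      isClosed_le continuous_const (by fun_prop)
    refine closure_minimal ?_ hcl hy
    rintro z ⟨t, ht, hz⟩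
    have h := ProperCone.mem_innerDual.1 hz hx.1
    rw [inner_add_right, hx.2, zero_add, real_inner_smul_right] at h
    exact nonneg_of_mul_nonneg_right h ht
  · intro h
    rw [dir_innerDual hu]
    refine mem_closure_of_forall_inner_nonneg _ fun x hx => ?_
    have hx' : ∀ d ∈ ProperCone.innerDual (K : Set Y), ∀ r : ℝ, 0 ≤ inner ℝ (d + r • u) x := by
      intro d hd r
      refine hx _ ?_
      rw [← SetLike.mem_coe, coe_coneAddSubspace]
      exact ⟨d, hd, r • u, Submodule.smul_mem _ _ (Submodule.mem_span_singleton_self u), rfl⟩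
    have hxK : x ∈ K := mem_of_forall_innerDual fun d hd => by simpa using hx' d hd 0
    rw [real_inner_comm]
    refine h x ⟨hxK, ?_⟩
    have h1 := hx' 0 (zero_mem _) 1
    have h2 := hx' 0 (zero_mem _) (-1)
    simp only [zero_add, one_smul, neg_smul, inner_neg_left] at h1 h2
    rw [real_inner_comm]
    linarith

/-- The tangent space of a dual cone is the orthogonal complement of the conjugate face. -/
theorem mem_tan_innerDual {u : Y} (hu : u ∈ ProperCone.innerDual (K : Set Y)) {y : Y} :
    y ∈ tan u (ProperCone.innerDual (K : Set Y) : Set Y) ↔ y ∈ perp (exposedFace K u) := by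
  rw [tan, Set.mem_inter_iff, Set.mem_neg, mem_closure_dir_innerDual hu,
    mem_closure_dir_innerDual hu, mem_perp, ← forall₂_and]
  refine forall₂_congr fun x _ => ?_
  rw [inner_neg_right]
  constructor
  · rintro ⟨h1, h2⟩
    linarith
  · intro h
    simp [h]

/-- In a nice cone, the dual of a face splits. -/
theorem IsNice.exists_add (hK : IsNice K) (hF : IsFace F (K : Set Y)) {y : Y}
    (hy : ∀ x ∈ F, 0 ≤ inner ℝ x y) :
    ∃ u ∈ ProperCone.innerDual (K : Set Y), ∃ v ∈ perp F, u + v = y := by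
  have hcl := hK F hF
  rw [← coe_coneAddSubspace] at hcl
  have hmem : y ∈
      closure (coneAddSubspace (ProperCone.innerDual (K : Set Y)) (perp F) : Set Y) := by
    refine mem_closure_of_forall_inner_nonneg _ fun x hx => ?_
    have hx' : ∀ d ∈ ProperCone.innerDual (K : Set Y), ∀ v ∈ perp F, 0 ≤ inner ℝ (d + v) x := by
      intro d hd v hv
      refine hx _ ?_
      rw [← SetLike.mem_coe, coe_coneAddSubspace]
      exact ⟨d, hd, v, hv, rfl⟩
    have hxK : x ∈ K := mem_of_forall_innerDual fun d hd => by simpa using hx' d hd 0 (zero_mem _)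
    have hspan : x ∈ Submodule.span ℝ F := by
      rw [← Submodule.orthogonal_orthogonal (Submodule.span ℝ F), Submodule.mem_orthogonal]
      intro v hv
      have h1 := hx' 0 (zero_mem _) v hv
      have h2 := hx' 0 (zero_mem _) (-v) ((perp F).neg_mem hv)
      simp only [zero_add, inner_neg_left] at h1 h2
      linarith
    rw [real_inner_comm]
    exact hy x (hF.mem_of_mem_span hxK hspan)
  rw [hcl.closure_eq, coe_coneAddSubspace] at hmem
  obtain ⟨u, hu, v, hv, h⟩ := hmem
  exact ⟨u, hu, v, hv, h⟩

end Duality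

/-! ### Separation over a face by the Riesz extension theorem -/

section Alternative

variable {Y : Type*} [NormedAddCommGroup Y] [InnerProductSpace ℝ Y] [FiniteDimensional ℝ Y]
  {K : ProperCone ℝ Y} {F : Set Y}

/-- The sum of a face of a cone and a linear subspace. -/
def IsFace.addSubspace (hF : IsFace F (K : Set Y)) (W : Submodule ℝ Y) : PointedCone ℝ Y where
  carrier := {d | ∃ f ∈ F, d - f ∈ W}
  zero_mem' := ⟨0, hF.zero_mem, by simp⟩
  add_mem' := by
    rintro x y ⟨f, hf, hx⟩ ⟨g, hg, hy⟩
    refine ⟨f + g, hF.add_mem hf hg, ?_⟩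
    rw [add_sub_add_comm]
    exact W.add_mem hx hy
  smul_mem' := by
    rintro ⟨c, hc⟩ x ⟨f, hf, hx⟩
    refine ⟨c • f, hF.smul_mem hf hc, ?_⟩
    change c • x - c • f ∈ W
    rw [← smul_sub]
    exact W.smul_mem _ hx

theorem IsFace.mem_addSubspace_of_mem (hF : IsFace F (K : Set Y)) {W : Submodule ℝ Y} {d : Y}
    (hd : d ∈ F) : d ∈ hF.addSubspace W := ⟨d, hd, by simp⟩

theorem IsFace.subspace_mem_addSubspace (hF : IsFace F (K : Set Y)) {W : Submodule ℝ Y} {d : Y}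
    (hd : d ∈ W) : d ∈ hF.addSubspace W := ⟨0, hF.zero_mem, by simpa⟩

/-- A linear functional nonnegative on the sum of a face and a subspace is represented by a vector
of the dual cone of the face that is orthogonal to the subspace. -/
theorem IsFace.exists_inner_eq (hF : IsFace F (K : Set Y)) {W : Submodule ℝ Y}
    (g : Y →ₗ[ℝ] ℝ) (hg : ∀ x ∈ hF.addSubspace W, 0 ≤ g x) :
    ∃ y : Y, (∀ x, inner ℝ x y = g x) ∧ (∀ x ∈ F, 0 ≤ inner ℝ x y) ∧ ∀ x ∈ W, inner ℝ x y = 0 := by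
  let y := (InnerProductSpace.toDual ℝ Y).symm (LinearMap.toContinuousLinearMap g)
  have hy : ∀ x, inner ℝ x y = g x := fun x => by
    rw [real_inner_comm]
    simp [y]
  refine ⟨y, hy, fun x hx => ?_, fun x hx => ?_⟩
  · rw [hy]
    exact hg x (hF.mem_addSubspace_of_mem hx)
  · have h1 := hg x (hF.subspace_mem_addSubspace hx)
    have h2 := hg (-x) (hF.subspace_mem_addSubspace (neg_mem hx))
    rw [map_neg] at h2
    rw [hy]
    linarith

/-- The point `f` absorbs only directions in the span of `F`. Adding `(span F + N)^⊥` to the cone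
lets `f` and `N` together absorb the whole space. -/
theorem IsFace.exists_add_mem_addSubspace (hF : IsFace F (K : Set Y)) {f : Y}
    (hf : f ∈ intrinsicInterior ℝ F) (N : Submodule ℝ Y) (y : Y) :
    ∃ t : ℝ, ∃ n ∈ N, t • f + n + y ∈
      hF.addSubspace (Submodule.span ℝ F ⊔ N)ᗮ := by
  obtain ⟨w, hw, z, hz, rfl⟩ :=
    (Submodule.span ℝ F ⊔ N).exists_add_mem_mem_orthogonal y
  obtain ⟨w', hw', n, hn, rfl⟩ := Submodule.mem_sup.1 hw
  obtain ⟨t, -, ht⟩ := hF.exists_smul_add_mem_of_mem_span hf hw'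
  refine ⟨t, -n, neg_mem hn, t • f + w', ht, ?_⟩
  convert hz using 1
  module

/-- The auxiliary summand `(span F + N)^⊥` does no harm: its component of a vector of `span F + N`
is orthogonal to itself. -/
theorem IsFace.sub_mem_of_mem_addSubspace (hF : IsFace F (K : Set Y)) {N : Submodule ℝ Y} {d : Y}
    (hd : d ∈ Submodule.span ℝ F ⊔ N)
    (h : d ∈ hF.addSubspace (N ⊔ (Submodule.span ℝ F ⊔ N)ᗮ)) : ∃ f ∈ F, d - f ∈ N := by
  obtain ⟨f, hf, h⟩ := h
  obtain ⟨n, hn, z, hz, e⟩ := Submodule.mem_sup.1 h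
  have hz' : z ∈ Submodule.span ℝ F ⊔ N := by
    have : z = d - f - n := by rw [← e]; abel
    rw [this]
    exact sub_mem (sub_mem hd (Submodule.mem_sup_left (Submodule.subset_span hf)))
      (Submodule.mem_sup_right hn)
  have hz0 : z = 0 := by
    have := Submodule.inner_right_of_mem_orthogonal hz' hz
    exact inner_self_eq_zero.1 this
  refine ⟨f, hf, ?_⟩
  rw [← e, hz0, add_zero]
  exact hn

/-- A theorem of the alternative: either a linear subspace meets the relative interior of a face, or
some vector orthogonal to the subspace lies in the dual of the face and does not vanish on it. -/
theorem IsFace.alternative (hF : IsFace F (K : Set Y)) {f : Y}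
    (hf : f ∈ intrinsicInterior ℝ F) (N : Submodule ℝ Y) :
    (∃ g ∈ F, f + g ∈ N) ∨
      ∃ y ∈ Nᗮ, (∀ x ∈ F, 0 ≤ inner ℝ x y) ∧ 0 < inner ℝ f y := by
  have hfF := intrinsicInterior_subset hf
  set W := N ⊔ (Submodule.span ℝ F ⊔ N)ᗮ with hW
  by_cases hD : -f ∈ hF.addSubspace W
  · left
    obtain ⟨g, hg, h⟩ := hF.sub_mem_of_mem_addSubspace
      (neg_mem (Submodule.mem_sup_left (Submodule.subset_span hfF))) hD
    refine ⟨g, hg, ?_⟩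
    rw [← neg_mem_iff]
    convert h using 1
    abel
  · right
    have hf0 : f ≠ 0 := by
      rintro rfl
      exact hD (by simp)
    -- The functional with value 1 at `f` is nonnegative on the part of the cone in `ℝf`, since a
    -- negative multiple of `f` there would put `-f` in the cone. Its extension vanishes on `W`,
    -- hence on `N`.
    let p : Y →ₗ.[ℝ] ℝ := LinearPMap.mkSpanSingleton f (1 : ℝ) hf0
    have hp : ∀ (c : ℝ) (h : c • f ∈ p.domain), p ⟨c • f, h⟩ = c := fun c h =>
      (LinearPMap.mkSpanSingleton'_apply f (1 : ℝ) _ c h).trans (by simp)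
    have hnonneg : ∀ x : p.domain, (x : Y) ∈ hF.addSubspace W → 0 ≤ p x := by
      rintro ⟨x, hx⟩ hxD
      obtain ⟨c, rfl⟩ := Submodule.mem_span_singleton.1 hx
      rw [hp]
      by_contra hc
      rw [not_le] at hc
      refine hD ?_
      have h := (hF.addSubspace W).smul_mem (inv_nonneg.2 (neg_nonneg.2 hc.le)) hxD
      convert h using 1
      rw [smul_smul, inv_neg, neg_mul, inv_mul_cancel₀ hc.ne, neg_smul, one_smul]
    have hdense : ∀ y, ∃ x : p.domain, (x : Y) + y ∈ hF.addSubspace W := by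
      intro y
      obtain ⟨t, n, hn, g, hg, h⟩ := hF.exists_add_mem_addSubspace hf N y
      refine ⟨⟨t • f, Submodule.smul_mem _ _ (Submodule.mem_span_singleton_self f)⟩, g, hg, ?_⟩
      have e : t • f + y - g = -n + (t • f + n + y - g) := by abel
      simp only [e]
      exact W.add_mem (Submodule.mem_sup_left (neg_mem hn)) (Submodule.mem_sup_right h)
    obtain ⟨g, hg, hg'⟩ := riesz_extension (hF.addSubspace W) p hnonneg hdense
    obtain ⟨y, hy, hyF, hyW⟩ := hF.exists_inner_eq g hg'
    refine ⟨y, (Submodule.mem_orthogonal _ _).2 fun n hn => hyW n (Submodule.mem_sup_left hn),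
      hyF, ?_⟩
    have h := hg ⟨(1 : ℝ) • f, Submodule.smul_mem _ _ (Submodule.mem_span_singleton_self f)⟩
    rw [hp] at h
    rw [hy, ← one_smul ℝ f, h]
    norm_num

/-- A linear functional nonnegative on the intersection of a face and a subspace that meets its
relative interior agrees on the subspace with a functional nonnegative on the face. -/
theorem IsFace.exists_dual_extension (hF : IsFace F (K : Set Y)) {f : Y}
    (hf : f ∈ intrinsicInterior ℝ F) {N : Submodule ℝ Y} (hfN : f ∈ N) (φ : Y →ₗ[ℝ] ℝ)
    (hφ : ∀ x ∈ N, x ∈ F → 0 ≤ φ x) :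
    ∃ y, (∀ x ∈ F, 0 ≤ inner ℝ x y) ∧ ∀ x ∈ N, inner ℝ x y = φ x := by
  let p : Y →ₗ.[ℝ] ℝ := ⟨N, φ.comp N.subtype⟩
  have hnonneg : ∀ x : p.domain, (x : Y) ∈ hF.addSubspace (Submodule.span ℝ F ⊔ N)ᗮ → 0 ≤ p x := by
    rintro ⟨x, hx⟩ ⟨f', hf', h⟩
    have h' : x - f' ∈ Submodule.span ℝ F ⊔ N :=
      sub_mem (Submodule.mem_sup_right hx) (Submodule.mem_sup_left (Submodule.subset_span hf'))
    have h0 := inner_self_eq_zero.1 (Submodule.inner_right_of_mem_orthogonal h' h)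
    rw [sub_eq_zero] at h0
    exact hφ x hx (h0 ▸ hf')
  have hdense : ∀ y, ∃ x : p.domain, (x : Y) + y ∈ hF.addSubspace (Submodule.span ℝ F ⊔ N)ᗮ := by
    intro y
    obtain ⟨t, n, hn, h⟩ := hF.exists_add_mem_addSubspace hf N y
    exact ⟨⟨t • f + n, N.add_mem (N.smul_mem t hfN) hn⟩, h⟩
  obtain ⟨g, hg, hg'⟩ := riesz_extension _ p hnonneg hdense
  obtain ⟨y, hy, hyF, -⟩ := hF.exists_inner_eq g hg'
  refine ⟨y, hyF, fun x hx => ?_⟩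
  rw [hy]
  exact hg ⟨x, hx⟩

end Alternative

/-! ### Facial reduction and strong duality of the extended dual -/

section FacialReduction

variable {X Y : Type*}
  [NormedAddCommGroup X] [InnerProductSpace ℝ X] [FiniteDimensional ℝ X]
  [NormedAddCommGroup Y] [InnerProductSpace ℝ Y] [FiniteDimensional ℝ Y]
  {A : X →ₗ[ℝ] Y} {b : Y} {K : ProperCone ℝ Y} {F G : Set Y}

/-- The linear map `(t, x) ↦ t b + A x`. -/
def homogenization (A : X →ₗ[ℝ] Y) (b : Y) : ℝ × X →ₗ[ℝ] Y :=
  (LinearMap.toSpanSingleton ℝ Y b).coprod A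

theorem homogenization_apply (A : X →ₗ[ℝ] Y) (b : Y) (t : ℝ) (x : X) :
    homogenization A b (t, x) = t • b + A x := by
  simp [homogenization]

theorem mem_nullAdj {y : Y} :
    y ∈ nullAdj A b ↔ LinearMap.adjoint A y = 0 ∧ inner ℝ b y = 0 := by
  simp [nullAdj, Submodule.mem_inf]

theorem nullAdj_eq_orthogonal (A : X →ₗ[ℝ] Y) (b : Y) :
    nullAdj A b = (LinearMap.range (homogenization A b))ᗮ := by
  ext y
  rw [mem_nullAdj, Submodule.mem_orthogonal]
  constructor
  · rintro ⟨h1, h2⟩ _ ⟨⟨t, x⟩, rfl⟩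
    rw [homogenization_apply, inner_add_left, real_inner_smul_left, h2,
      ← LinearMap.adjoint_inner_right, h1, inner_zero_right, mul_zero, add_zero]
  · intro h
    constructor
    · have := h (homogenization A b (0, LinearMap.adjoint A y)) ⟨_, rfl⟩
      rw [homogenization_apply, zero_smul, zero_add, ← LinearMap.adjoint_inner_right] at this
      exact inner_self_eq_zero.1 this
    · have := h (homogenization A b (1, 0)) ⟨_, rfl⟩
      rwa [homogenization_apply, one_smul, map_zero, add_zero] at this

theorem inner_slack_eq (y : Y) (x : X) :
    inner ℝ (b - A x) y = inner ℝ b y - inner ℝ (LinearMap.adjoint A y) x := by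
  rw [inner_sub_left, ← LinearMap.adjoint_inner_right, real_inner_comm x]

theorem inner_slack_eq_zero {y : Y} (hy : y ∈ nullAdj A b) (x : X) :
    inner ℝ (b - A x) y = 0 := by
  obtain ⟨h1, h2⟩ := mem_nullAdj.1 hy
  rw [inner_slack_eq, h1, h2, inner_zero_left, sub_zero]

theorem convex_feas (A : X →ₗ[ℝ] Y) (b : Y) (K : ProperCone ℝ Y) : Convex ℝ (feas A b K) := by
  intro x hx y hy s t hs ht hst
  have h : s • (b - A x) + t • (b - A y) ∈ K := add_mem (K.smul_mem hx hs) (K.smul_mem hy ht)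
  change b - A (s • x + t • y) ∈ K
  convert h using 1
  rw [map_add, map_smul, map_smul]
  calc b - (s • A x + t • A y) = (s + t) • b - (s • A x + t • A y) := by rw [hst, one_smul]
    _ = _ := by module

/-- A face containing the slack of a relative interior point of the feasible set contains the slacks
of all feasible points. -/
theorem IsFace.slack_mem (hF : IsFace F (K : Set Y)) {x₀ x : X}
    (hx₀ : x₀ ∈ intrinsicInterior ℝ (feas A b K)) (h₀ : b - A x₀ ∈ F) (hx : x ∈ feas A b K) :
    b - A x ∈ F := by
  obtain ⟨t, ht, h⟩ := exists_prolong_of_mem_intrinsicInterior hx₀ hx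
  refine hF.mem_of_smul_mem ht
    (hF.left_mem_of_add_mem (K.smul_mem hx ht.le) (h : b - A (x₀ + t • (x₀ - x)) ∈ K) ?_)
  convert hF.smul_mem h₀ (t := 1 + t) (by positivity) using 1
  rw [map_add, map_smul, map_sub]
  module

theorem existsUnique_isMinimalCone (h : (feas A b K).Nonempty) :
    ∃! F : Set Y, IsMinimalCone A b K F := by
  obtain ⟨x, hx⟩ := Set.Nonempty.intrinsicInterior (convex_feas A b K) h
  obtain ⟨F, hF, hxF⟩ := exists_isFace_mem_intrinsicInterior (intrinsicInterior_subset hx :)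
  refine ⟨F, ⟨hF, x, hx, hxF⟩, ?_⟩
  rintro G ⟨hG, y, hy, hyG⟩
  exact subset_antisymm
    (hG.subset_of_mem hF hyG
      (hF.slack_mem hx (intrinsicInterior_subset hxF) (intrinsicInterior_subset hy)))
    (hF.subset_of_mem hG hxF
      (hG.slack_mem hy (intrinsicInterior_subset hyG) (intrinsicInterior_subset hx)))

/-- A point of the cone in the image of the homogenization, with positive first coordinate, lies in
every face containing all slacks. -/
theorem IsFace.homogenization_mem (hF : IsFace F (K : Set Y))
    (hslack : ∀ x ∈ feas A b K, b - A x ∈ F) {t : ℝ} (ht : 0 < t) {x : X}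
    (h : t • b + A x ∈ K) : t • b + A x ∈ F := by
  have e : t • b + A x = t • (b - A (-t⁻¹ • x)) := by
    rw [map_smul, smul_sub, smul_smul]
    simp [ht.ne']
  rw [e] at h ⊢
  refine hF.smul_mem (hslack _ ?_) ht.le
  have := K.smul_mem h (inv_nonneg.2 ht.le)
  rwa [smul_smul, inv_mul_cancel₀ ht.ne', one_smul] at this

/-- One step of facial reduction. -/
theorem IsMinimalCone.exists_reducing (hF : IsMinimalCone A b K F) (hG : IsFace G (K : Set Y))
    (hne : ¬ G ⊆ F) :
    ∃ y ∈ nullAdj A b, (∀ x ∈ G, 0 ≤ inner ℝ x y) ∧ ∃ x ∈ G, inner ℝ x y ≠ 0 := by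
  obtain ⟨hFK, x₀, hx₀, hs⟩ := hF
  have hsF := intrinsicInterior_subset hs
  have hslack : ∀ x ∈ feas A b K, b - A x ∈ F := fun x hx => hFK.slack_mem hx₀ hsF hx
  obtain ⟨g₀, hg₀⟩ := Set.Nonempty.intrinsicInterior hG.convex hG.nonempty
  have hg₀G := intrinsicInterior_subset hg₀
  rcases hG.alternative hg₀ (LinearMap.range (homogenization A b)) with h | h
  · exfalso
    obtain ⟨g, hg, ⟨t, x⟩, e⟩ := h
    rw [homogenization_apply] at e
    refine hne (hG.subset_of_mem hFK hg₀ ?_)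
    -- The sign of `t` is unknown; adding `|t| + 1` copies of a slack makes the coefficient of `b`
    -- positive. The sum is then a multiple of a slack, so it lies in `F`, and so does its summand
    -- `g₀`.
    have hk : 0 ≤ |t| + 1 := by positivity
    have hsum : g₀ + (g + (|t| + 1) • (b - A x₀)) =
        (t + (|t| + 1)) • b + A (x - (|t| + 1) • x₀) := by
      rw [← add_assoc, ← e, map_sub, map_smul]
      module
    have hgK : g + (|t| + 1) • (b - A x₀) ∈ K :=
      add_mem (hG.subset hg) (K.smul_mem (hFK.subset hsF) hk)
    refine hFK.left_mem_of_add_mem (hG.subset hg₀G) hgK ?_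
    have hK := add_mem (hG.subset hg₀G : g₀ ∈ K) hgK
    rw [hsum] at hK ⊢
    exact hFK.homogenization_mem hslack (by linarith [neg_abs_le t]) hK
  · obtain ⟨y, hy, h1, h2⟩ := h
    rw [← nullAdj_eq_orthogonal] at hy
    exact ⟨y, hy, h1, g₀, hg₀G, h2.ne'⟩

/-- The pairs `(u, v)` occurring in facial reduction towards the face `F`. -/
structure ReducingPair (A : X →ₗ[ℝ] Y) (b : Y) (K : ProperCone ℝ Y) (F : Set Y) (p : Y × Y) :
    Prop where
  fst_mem : p.1 ∈ ProperCone.innerDual (K : Set Y)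
  add_mem : p.1 + p.2 ∈ nullAdj A b
  snd_mem : p.2 ∈ perp (exposedFace K p.1)
  subset : F ⊆ exposedFace K p.1

/-- Niceness splits a reducing vector as `y = u + v`, and `p + (u, v)` is the next pair: its first
entry exposes the current face cut by `u^⊥`. As `y` vanishes on the new face but not on the old one,
it is a new dimension of `L ∩ G^⊥`. When `F` has been reached, the pair is repeated, so that
sequences can be padded to any length. -/
theorem ReducingPair.exists_next (hK : IsNice K) (hF : IsMinimalCone A b K F) {p : Y × Y}
    (hp : ReducingPair A b K F p) :
    ∃ q, ReducingPair A b K F q ∧ q.2 ∈ perp (exposedFace K p.1) ∧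
      exposedFace K q.1 ⊆ exposedFace K p.1 ∧
      (exposedFace K p.1 ≠ F → ¬ exposedFace K p.1 ⊆ exposedFace K q.1 ∧
        ∃ y ∈ nullAdj A b, y ∈ perp (exposedFace K q.1) ∧ y ∉ perp (exposedFace K p.1)) := by
  by_cases h : exposedFace K p.1 = F
  · exact ⟨p, hp, hp.snd_mem, subset_rfl, fun h' => absurd h h'⟩
  have hG := isFace_exposedFace hp.fst_mem
  obtain ⟨y, hyL, hy, x, hx, hxy⟩ := hF.exists_reducing hG
    fun h' => h (subset_antisymm h' hp.subset)
  obtain ⟨u, hu, v, hv, rfl⟩ := hK.exists_add hG hy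
  have hinner : ∀ z ∈ exposedFace K p.1, inner ℝ z (u + v) = inner ℝ z u := fun z hz => by
    rw [inner_add_right, mem_perp.1 hv z hz, add_zero]
  have hexp := exposedFace_add hp.fst_mem hu
  have hsub : exposedFace K (p.1 + u) ⊆ exposedFace K p.1 := by
    rw [hexp]
    exact Set.inter_subset_left
  have hv' : p.2 + v ∈ perp (exposedFace K p.1) := Submodule.add_mem _ hp.snd_mem hv
  refine ⟨(p.1 + u, p.2 + v), ⟨?_, ?_, perp_anti hsub hv', ?_⟩, hv', hsub, fun _ => ⟨?_, u + v, hyL,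
    ?_, fun hmem => hxy (mem_perp.1 hmem x hx)⟩⟩
  · exact AddMemClass.add_mem hp.fst_mem hu
  · have := (nullAdj A b).add_mem hp.add_mem hyL
    convert this using 1
    simp only
    abel
  · obtain ⟨hFK, x₀, hx₀, hs⟩ := hF
    refine hFK.subset_of_mem (isFace_exposedFace (AddMemClass.add_mem hp.fst_mem hu)) hs ?_
    rw [hexp]
    have hsF := intrinsicInterior_subset hs
    refine ⟨hp.subset hsF, hFK.subset hsF, ?_⟩
    rw [← hinner _ (hp.subset hsF)]
    exact inner_slack_eq_zero hyL x₀
  · intro h'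
    have := h' hx
    rw [hexp] at this
    exact hxy ((hinner x hx).trans this.2.2)
  · refine mem_perp.2 fun z hz => ?_
    rw [hinner z (hsub hz)]
    rw [hexp] at hz
    exact hz.2.2

/-- Facial reduction reaches the minimal cone in at most `min {ℓ_K - 1, dim L}` steps. -/
theorem IsMinimalCone.exists_reducing_sequence (hK : IsNice K) (hF : IsMinimalCone A b K F) :
    ∃ s : ℕ → Y × Y, s 0 = 0 ∧ (∀ i, ReducingPair A b K F (s i)) ∧
      (∀ i, (s (i + 1)).2 ∈ perp (exposedFace K (s i).1)) ∧
      ∀ l : ℕ, min (faceChainLength K - 1) (Module.finrank ℝ (nullAdj A b) : ℕ∞) ≤ l →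
        exposedFace K (s l).1 = F := by
  classical
  have h0 : ReducingPair A b K F 0 :=
    ⟨zero_mem _, by simp, by simp, by
      rw [Prod.fst_zero, exposedFace_zero]
      exact hF.1.subset⟩
  choose! next hnext using fun p (hp : ReducingPair A b K F p) => hp.exists_next hK hF
  let s : ℕ → Y × Y := fun i => next^[i] 0
  have hsucc : ∀ i, s (i + 1) = next (s i) := fun i => Function.iterate_succ_apply' next i 0
  have hs : ∀ i, ReducingPair A b K F (s i) := by
    intro i
    induction i with
    | zero => exact h0
    | succ i ih =>
      rw [hsucc]
      exact (hnext _ ih).1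
  refine ⟨s, rfl, hs, fun i => ?_, fun l hl => ?_⟩
  · rw [hsucc]
    exact (hnext _ (hs i)).2.1
  let E : ℕ → Set Y := fun i => exposedFace K (s i).1
  have hanti : Antitone E := antitone_nat_of_succ_le fun i => by
    simp only [E, hsucc]
    exact (hnext _ (hs i)).2.2.1
  -- Both potentials at once: `k` strict steps give `k` dimensions of `L ∩ E_k^⊥` and a chain of `k
  -- + 1` faces with least member `E k`.
  have key : ∀ k, (∀ j < k, E j ≠ F) →
      k ≤ Module.finrank ℝ (nullAdj A b ⊓ perp (E k) : Submodule ℝ Y) ∧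
      ∃ t ⊆ {F : Set Y | IsFace F (K : Set Y)}, t.encard = k + 1 ∧ IsChain (· ⊆ ·) t ∧
        ∀ G ∈ t, E k ⊆ G := by
    intro k
    induction k with
    | zero =>
      intro _
      refine ⟨Nat.zero_le _, {E 0}, ?_, by simp, by simp, by simp⟩
      simpa using isFace_exposedFace (hs 0).fst_mem
    | succ k ih =>
      intro hk
      obtain ⟨ih1, t, ht, hcard, hchain, hsub⟩ :=
        ih fun j hj => hk j (hj.trans (Nat.lt_succ_self k))
      obtain ⟨hnot, y, hyL, hyk, hyk'⟩ := (hnext _ (hs k)).2.2.2 (hk k (Nat.lt_succ_self k))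
      rw [← hsucc] at hnot hyk
      constructor
      · refine Nat.succ_le_of_lt (ih1.trans_lt (Submodule.finrank_lt_finrank_of_lt ?_))
        refine lt_of_le_of_ne (inf_le_inf_left _ (perp_anti (hanti (Nat.le_succ k)))) fun e => ?_
        have : y ∈ nullAdj A b ⊓ perp (E (k + 1)) := ⟨hyL, hyk⟩
        rw [← e] at this
        exact hyk' this.2
      · have hnotmem : E (k + 1) ∉ t := fun hmem => hnot (hsub _ hmem)
        refine ⟨insert (E (k + 1)) t, ?_, ?_, ?_, ?_⟩
        · exact Set.insert_subset (isFace_exposedFace (hs _).fst_mem) ht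
        · rw [Set.encard_insert_of_notMem hnotmem, hcard]
          push_cast
          rfl
        · exact hchain.insert fun G hG _ => Or.inl ((hanti (Nat.le_succ k)).trans (hsub G hG))
        · rintro G (rfl | hG)
          · exact subset_rfl
          · exact (hanti (Nat.le_succ k)).trans (hsub G hG)
  -- If `E l ≠ F`, then no earlier face is `F` either, and step `l + 1` is still strict. This yields
  -- a chain of `l + 2` faces and `dim L ≥ l + 1`, against the choice of `l`.
  by_contra hne
  have hall : ∀ j < l + 1, E j ≠ F := fun j hj e =>
    hne (subset_antisymm (e ▸ hanti (Nat.lt_succ_iff.1 hj)) (hs l).subset)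
  obtain ⟨h1, t, ht, hcard, hchain, -⟩ := key (l + 1) hall
  have h2 : ((l + 1 : ℕ) : ℕ∞) ≤ Module.finrank ℝ (nullAdj A b) :=
    Nat.cast_le.2 (h1.trans (Submodule.finrank_mono inf_le_left))
  have h3 : ((l + 1 : ℕ) : ℕ∞) ≤ faceChainLength K - 1 := by
    refine ENat.le_sub_of_add_le_right (by simp) ?_
    rw [← hcard]
    exact Set.encard_le_chainHeight_of_isChain _ t ht hchain
  have h4 := (le_min h3 h2).trans hl
  rw [Nat.cast_le] at h4
  omega

/-- The dual of the minimal cone in terms of the simplified extended system. -/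
theorem IsMinimalCone.innerDual_eq (hK : IsNice K) (hF : IsMinimalCone A b K F) {l : ℕ}
    (hl : min (faceChainLength K - 1) (Module.finrank ℝ (nullAdj A b) : ℕ∞) ≤ l) :
    (ProperCone.innerDual F : Set Y) =
      {y | ∃ u v : Fin (l + 2) → Y, ExtNiceSimple A b K l u v ∧
        y = u (Fin.last _) + v (Fin.last _)} := by
  ext y
  constructor
  · intro hy
    obtain ⟨s, hs0, hs, htan, hlast⟩ := hF.exists_reducing_sequence hK
    have hl := hlast l hl
    obtain ⟨u, hu, v, hv, rfl⟩ := hK.exists_add hF.1 fun x hx => hy hx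
    -- The reducing sequence fills the indices up to `l`; the splitting of `y` is the last pair. Its
    -- `v ∈ F^⊥` is tangent at `u_l` because that vector exposes `F`.
    refine ⟨fun i => if (i : ℕ) ≤ l then (s i).1 else u,
      fun i => if (i : ℕ) ≤ l then (s i).2 else v, ⟨?_, ?_, ?_, ?_, ?_⟩, ?_⟩
    · simp [hs0]
    · simp [hs0]
    · intro i
      split_ifs
      · exact (hs _).fst_mem
      · exact hu
    · intro i
      have hi : (i.castSucc : ℕ) ≤ l := Nat.lt_succ_iff.1 i.2
      simp only [hi, if_true]
      rw [mem_tan_innerDual (hs _).fst_mem]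
      split_ifs with h
      · exact htan i
      · have e : (i.castSucc : ℕ) = l := by
          rw [Fin.val_succ] at h
          rw [Fin.val_castSucc] at hi ⊢
          omega
        rw [e, hl]
        exact hv
    · intro i
      have hi : (i.succ.castSucc : ℕ) ≤ l := i.2
      simp only [hi, if_true]
      exact (hs _).add_mem
    · simp
  · rintro ⟨u, v, h, rfl⟩
    obtain ⟨hFK, x₀, hx₀, hs⟩ := hF
    have hsF := intrinsicInterior_subset hs
    have hu : ∀ i, u i ∈ ProperCone.innerDual (K : Set Y) := by
      intro i
      refine Fin.cases ?_ (fun i => h.u_mem i) i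
      rw [h.u_zero]
      exact zero_mem _
    have hsub : ∀ i : Fin (l + 1), F ⊆ exposedFace K (u i.castSucc) := by
      intro i
      induction i using Fin.induction with
      | zero =>
        rw [Fin.castSucc_zero, h.u_zero, exposedFace_zero]
        exact hFK.subset
      | succ i ih =>
        -- It is enough to test the relative interior slack: it is orthogonal to `u + v ∈ L`, and to
        -- `v` by the induction hypothesis, hence to `u`.
        refine hFK.subset_of_mem (isFace_exposedFace (hu _)) hs ⟨hFK.subset hsF, ?_⟩
        have h1 := inner_slack_eq_zero (h.add_mem i) x₀
        have h2 := h.v_mem i.castSucc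
        rw [mem_tan_innerDual (hu _)] at h2
        have h3 := mem_perp.1 h2 _ (ih hsF)
        rw [← Fin.succ_castSucc] at h1 ⊢
        rwa [inner_add_right, h3, add_zero] at h1
    have h2 := h.v_mem (Fin.last l)
    rw [mem_tan_innerDual (hu _), Fin.succ_last] at h2
    refine ProperCone.mem_innerDual.2 fun x hx => ?_
    rw [inner_add_right, mem_perp.1 h2 x (hsub _ hx), add_zero]
    exact ProperCone.mem_innerDual.1 (hu _) (hFK.subset hx)

/-- Strong duality over the minimal cone. -/
theorem IsMinimalCone.exists_dual_solution (hF : IsMinimalCone A b K F) {c : X} {p : ℝ}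
    (hp : IsLUB (primalValues A b K c) p) :
    ∃ y ∈ ProperCone.innerDual F, LinearMap.adjoint A y = c ∧ inner ℝ b y = p := by
  obtain ⟨hFK, x₀, hx₀, hs⟩ := hF
  have hx₀' := intrinsicInterior_subset hx₀
  have hsF := intrinsicInterior_subset hs
  have hup : ∀ x ∈ feas A b K, inner ℝ c x ≤ p := fun x hx => hp.1 ⟨x, hx, rfl⟩
  -- Optimality of `p` says that `ψ` is nonnegative wherever `t b + A x ∈ K`. Then `ψ` factors
  -- through the homogenization, and the factor extends to an element of `F*`, the dual solution.
  let ψ : ℝ × X →ₗ[ℝ] ℝ := (LinearMap.toSpanSingleton ℝ ℝ p).coprod (innerₗ X c)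
  have hψ : ∀ t x, ψ (t, x) = t * p + inner ℝ c x := fun t x => by simp [ψ]
  have hpos : ∀ t x, 0 < t → homogenization A b (t, x) ∈ K → 0 ≤ ψ (t, x) := by
    intro t x ht h
    rw [homogenization_apply] at h
    have hfeas : -t⁻¹ • x ∈ feas A b K := by
      have := K.smul_mem h (inv_nonneg.2 ht.le)
      change b - A (-t⁻¹ • x) ∈ K
      convert this using 1
      rw [map_smul, smul_add, smul_smul, inv_mul_cancel₀ ht.ne', one_smul]
      module
    have := hup _ hfeas
    rw [real_inner_smul_right] at this
    rw [hψ]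
    have h2 := mul_le_mul_of_nonneg_left this ht.le
    rw [← mul_assoc, mul_neg, mul_inv_cancel₀ ht.ne'] at h2
    linarith
  have hnonneg : ∀ q, homogenization A b q ∈ K → 0 ≤ ψ q := by
    rintro ⟨t, x⟩ h
    rcases lt_or_ge 0 t with ht | ht
    · exact hpos t x ht h
    · by_contra! hneg
      have ht1 : 0 < 1 - t := by linarith
      -- Adding `1 - t` copies of the slack of `x'` raises the first coordinate to 1. With `x'` this
      -- close to optimal, `ψ` would still be negative there.
      have hlt : p - -ψ (t, x) / (1 - t) < p := by
        have : 0 < -ψ (t, x) / (1 - t) := div_pos (by linarith) ht1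
        linarith
      obtain ⟨_, ⟨x', hx', rfl⟩, hlt'⟩ := (lt_isLUB_iff hp).1 hlt
      have hK := add_mem h (K.smul_mem hx' ht1.le)
      have e : homogenization A b (t, x) + (1 - t) • (b - A x') =
          homogenization A b (1, x - (1 - t) • x') := by
        rw [homogenization_apply, homogenization_apply, map_sub, map_smul]
        module
      rw [e] at hK
      have h1 := hpos 1 _ one_pos hK
      have h2 : p - inner ℝ c x' < -ψ (t, x) / (1 - t) := by linarith
      rw [lt_div_iff₀ ht1] at h2
      rw [hψ] at h1 h2
      rw [inner_sub_right, real_inner_smul_right] at h1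
      linarith
  have hker : ψ ∈ LinearMap.range (homogenization A b).dualMap := by
    rw [LinearMap.range_dualMap_eq_dualAnnihilator_ker, Submodule.mem_dualAnnihilator]
    intro q hq
    have h1 := hnonneg q (by rw [LinearMap.mem_ker.1 hq]; exact zero_mem K)
    have h2 := hnonneg (-q) (by rw [map_neg, LinearMap.mem_ker.1 hq, neg_zero]; exact zero_mem K)
    rw [map_neg] at h2
    linarith
  obtain ⟨φ, hφ⟩ := hker
  have hφ' : ∀ q, φ (homogenization A b q) = ψ q := fun q => by rw [← hφ]; rfl
  obtain ⟨y, hyF, hy⟩ := hFK.exists_dual_extension hs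
    (N := LinearMap.range (homogenization A b))
    ⟨(1, -x₀), by rw [homogenization_apply, one_smul, map_neg, sub_eq_add_neg]⟩ φ (by
      rintro _ ⟨q, rfl⟩ hq
      rw [hφ']
      exact hnonneg q (hFK.subset hq))
  have hy' : ∀ t x, inner ℝ (t • b + A x) y = t * p + inner ℝ c x := fun t x => by
    rw [← homogenization_apply, hy _ ⟨_, rfl⟩, hφ', hψ]
  refine ⟨y, ProperCone.mem_innerDual.2 fun x hx => hyF x hx, ?_, ?_⟩
  · refine ext_inner_right ℝ fun x => ?_
    have := hy' 0 x
    rwa [zero_smul, zero_add, zero_mul, zero_add, real_inner_comm,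
      ← LinearMap.adjoint_inner_left] at this
  · have := hy' 1 0
    simpa using this

/-- Strong duality of the simplified extended dual. -/
theorem strongDuality_extDualValues (hK : IsNice K) (hfeas : (feas A b K).Nonempty) {l : ℕ}
    (hl : min (faceChainLength K - 1) (Module.finrank ℝ (nullAdj A b) : ℕ∞) ≤ l) (c : X) :
    StrongDuality (primalValues A b K c) (extDualValues A b K c l) := by
  obtain ⟨F, hF, -⟩ := existsUnique_isMinimalCone hfeas
  have hdual : extDualValues A b K c l =
      {r | ∃ y ∈ ProperCone.innerDual F, LinearMap.adjoint A y = c ∧ r = inner ℝ b y} := by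
    ext r
    have hmem : ∀ y, y ∈ ProperCone.innerDual F ↔ ∃ u v : Fin (l + 2) → Y,
        ExtNiceSimple A b K l u v ∧ y = u (Fin.last _) + v (Fin.last _) := fun y => by
      rw [← SetLike.mem_coe, hF.innerDual_eq hK hl]
      rfl
    constructor
    · rintro ⟨u, v, h, hc, rfl⟩
      exact ⟨_, (hmem _).2 ⟨u, v, h, rfl⟩, hc, rfl⟩
    · rintro ⟨y, hy, hc, rfl⟩
      obtain ⟨u, v, h, rfl⟩ := (hmem y).1 hy
      exact ⟨u, v, h, hc, rfl⟩
  rw [hdual]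
  have hne : (primalValues A b K c).Nonempty := by
    obtain ⟨x, hx⟩ := hfeas
    exact ⟨_, x, hx, rfl⟩
  have hweak : ∀ y ∈ ProperCone.innerDual F, LinearMap.adjoint A y = c →
      inner ℝ b y ∈ upperBounds (primalValues A b K c) := by
    rintro y hy rfl _ ⟨x, hx, rfl⟩
    obtain ⟨hFK, x₀, hx₀, hs⟩ := hF
    have := ProperCone.mem_innerDual.1 hy (hFK.slack_mem hx₀ (intrinsicInterior_subset hs) hx)
    rw [inner_slack_eq] at this
    linarith
  have hstrong : BddAbove (primalValues A b K c) → ∃ p : ℝ, IsLUB (primalValues A b K c) p ∧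
      IsLeast {r | ∃ y ∈ ProperCone.innerDual F,
        LinearMap.adjoint A y = c ∧ r = inner ℝ b y} p := by
    intro hbdd
    have hp := isLUB_csSup hne hbdd
    obtain ⟨y, hy, hc, e⟩ := hF.exists_dual_solution hp
    refine ⟨_, hp, ⟨y, hy, hc, e.symm⟩, ?_⟩
    rintro _ ⟨z, hz, hzc, rfl⟩
    exact hp.2 (hweak z hz hzc)
  refine ⟨⟨fun hbdd => ?_, ?_⟩, hstrong⟩
  · obtain ⟨p, -, hp⟩ := hstrong hbdd
    exact ⟨p, hp.1⟩
  · rintro ⟨_, y, hy, hc, rfl⟩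
    exact ⟨_, hweak y hy hc⟩

theorem ell_spec (A : X →ₗ[ℝ] Y) (b : Y) (K : ProperCone ℝ Y) :
    min (faceChainLength K - 1) (Module.finrank ℝ (nullAdj A b) : ℕ∞) ≤ (ell A b K : ℕ∞) := by
  rw [ell, ENat.natCast_toNat]
  exact ne_top_of_le_ne_top (ENat.natCast_ne_top _) (min_le_right _ _)

end FacialReduction

/-! ### The positive semidefinite cone in the space of symmetric matrices -/

section SymmetricMatrices

open Matrix

variable {n : ℕ}

/-- The Euclidean space of real symmetric matrices. -/
def SymMat (n : ℕ) : Submodule ℝ (EuclideanSpace ℝ (Fin n × Fin n)) where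
  carrier := {x | ∀ i j, x (i, j) = x (j, i)}
  zero_mem' := by simp
  add_mem' := fun {x y} hx hy i j => by
    simp only [PiLp.add_apply]
    rw [hx i j, hy i j]
  smul_mem' := fun c x hx i j => by
    simp only [PiLp.smul_apply]
    rw [hx i j]

/-- The matrix of an element of the space of symmetric matrices. -/
def toMat : SymMat n →ₗ[ℝ] Matrix (Fin n) (Fin n) ℝ where
  toFun x := Matrix.of fun i j => (x : EuclideanSpace ℝ (Fin n × Fin n)) (i, j)
  map_add' _ _ := rfl
  map_smul' _ _ := rfl

theorem toMat_apply (x : SymMat n) (i j : Fin n) :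
    toMat x i j = (x : EuclideanSpace ℝ (Fin n × Fin n)) (i, j) := rfl

theorem toMat_isSymm (x : SymMat n) : (toMat x).IsSymm := by
  ext i j
  exact x.2 j i

theorem toMat_injective : Function.Injective (toMat (n := n)) := by
  intro x y h
  apply Subtype.ext
  ext ⟨i, j⟩
  exact congrFun (congrFun h i) j

/-- The symmetric part of a matrix. -/
def symPart (M : Matrix (Fin n) (Fin n) ℝ) : SymMat n :=
  ⟨WithLp.toLp 2 fun p => (1 / 2 : ℝ) * (M p.1 p.2 + M p.2 p.1), fun i j => by
    simp [add_comm]⟩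

theorem toMat_symPart {M : Matrix (Fin n) (Fin n) ℝ} (hM : M.IsSymm) : toMat (symPart M) = M := by
  ext i j
  change (1 / 2 : ℝ) * (M i j + M j i) = M i j
  rw [hM.apply i j]
  ring

theorem inner_eq_matInner (x y : SymMat n) : inner ℝ x y = matInner (toMat x) (toMat y) := by
  rw [Submodule.coe_inner, PiLp.inner_apply, Fintype.sum_prod_type, matInner]
  refine Finset.sum_congr rfl fun i _ => Finset.sum_congr rfl fun j _ => ?_
  simp [toMat_apply, mul_comm]

/-- The symmetric matrix `z zᵀ`. -/
def rankOne (z : Fin n → ℝ) : SymMat n := symPart (vecMulVec z z)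

theorem isSymm_vecMulVec_self (z : Fin n → ℝ) : (vecMulVec z z).IsSymm := by
  ext i j
  simp [vecMulVec_apply, mul_comm]

theorem toMat_rankOne (z : Fin n → ℝ) : toMat (rankOne z) = vecMulVec z z :=
  toMat_symPart (isSymm_vecMulVec_self z)

theorem inner_rankOne (z : Fin n → ℝ) (x : SymMat n) :
    inner ℝ (rankOne z) x = z ⬝ᵥ toMat x *ᵥ z := by
  rw [inner_eq_matInner, toMat_rankOne, matInner]
  simp only [dotProduct, mulVec, Finset.mul_sum, vecMulVec_apply]
  exact Finset.sum_congr rfl fun i _ => Finset.sum_congr rfl fun j _ => by ring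

theorem dotProduct_congruence (M Q : Matrix (Fin n) (Fin n) ℝ) (z : Fin n → ℝ) :
    Q *ᵥ z ⬝ᵥ M *ᵥ (Q *ᵥ z) = z ⬝ᵥ (Qᵀ * M * Q) *ᵥ z := by
  rw [← mulVec_mulVec, ← mulVec_mulVec, dotProduct_mulVec z, vecMul_transpose]

/-- The cone of positive semidefinite matrices. -/
def psdCone (n : ℕ) : ProperCone ℝ (SymMat n) :=
  ProperCone.innerDual (Set.range rankOne)

theorem mem_psdCone_iff_inner {x : SymMat n} :
    x ∈ psdCone n ↔ ∀ z, 0 ≤ inner ℝ (rankOne z) x := by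
  rw [psdCone, ProperCone.mem_innerDual, Set.forall_mem_range]

theorem posSemidef_iff_dotProduct {m : Type*} [Fintype m] {M : Matrix m m ℝ} :
    M.PosSemidef ↔ M.IsSymm ∧ ∀ z, 0 ≤ z ⬝ᵥ M *ᵥ z := by
  rw [posSemidef_iff_dotProduct_mulVec]
  simp [IsHermitian, IsSymm, conjTranspose_eq_transpose_of_trivial]

theorem mem_psdCone {x : SymMat n} : x ∈ psdCone n ↔ (toMat x).PosSemidef := by
  rw [mem_psdCone_iff_inner, posSemidef_iff_dotProduct]
  simp only [inner_rankOne, toMat_isSymm, true_and]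

theorem rankOne_mem_psdCone (z : Fin n → ℝ) : rankOne z ∈ psdCone n := by
  rw [mem_psdCone, toMat_rankOne]
  simpa using posSemidef_vecMulVec_self_star z

theorem exists_eq_sum_rankOne {x : SymMat n} (hx : x ∈ psdCone n) :
    ∃ (m : ℕ) (z : Fin m → Fin n → ℝ), x = ∑ j, rankOne (z j) := by
  obtain ⟨m, z, h⟩ := posSemidef_iff_eq_sum_vecMulVec.1 (mem_psdCone.1 hx)
  refine ⟨m, z, toMat_injective ?_⟩
  rw [h, map_sum]
  refine Finset.sum_congr rfl fun j _ => ?_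
  rw [toMat_rankOne]
  simp

/-- Self-duality: the rank-one matrices generate the cone, which is by definition the dual of the
set of them. -/
theorem innerDual_psdCone (n : ℕ) :
    ProperCone.innerDual (psdCone n : Set (SymMat n)) = psdCone n := by
  ext y
  constructor
  · intro h
    exact mem_psdCone_iff_inner.2 fun z => ProperCone.mem_innerDual.1 h (rankOne_mem_psdCone z)
  · intro h
    refine ProperCone.mem_innerDual.2 fun x hx => ?_
    obtain ⟨m, z, rfl⟩ := exists_eq_sum_rankOne hx
    rw [sum_inner]
    exact Finset.sum_nonneg fun j _ => mem_psdCone_iff_inner.1 h _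

theorem finrank_symMat_le (n : ℕ) : Module.finrank ℝ (SymMat n) ≤ n * (n + 1) / 2 := by
  let f : SymMat n →ₗ[ℝ] Sym2 (Fin n) → ℝ :=
    { toFun := fun x s => Sym2.lift ⟨fun i j => toMat x i j, fun i j => x.2 i j⟩ s
      map_add' := fun x y => by
        ext s
        induction s with | _ i j => rfl
      map_smul' := fun c x => by
        ext s
        induction s with | _ i j => rfl }
  have hf : Function.Injective f := by
    intro x y h
    refine toMat_injective ?_
    ext i j
    exact congrFun h s(i, j)
  have := LinearMap.finrank_le_finrank_of_injective hf
  rwa [Module.finrank_fintype_fun_eq_card, Sym2.card, Fintype.card_fin, Nat.choose_two_right,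
    Nat.add_sub_cancel, mul_comm] at this

/-! ### Faces of the semidefinite cone: chain length and niceness -/

section Faces

variable {E E' : Set (SymMat n)}

theorem IsFace.mem_of_sum_mem {Y : Type*} [NormedAddCommGroup Y] [InnerProductSpace ℝ Y]
    {K : ProperCone ℝ Y} {F : Set Y} (hF : IsFace F (K : Set Y)) {ι : Type*} [Fintype ι]
    {x : ι → Y} (hx : ∀ i, x i ∈ K) (h : ∑ i, x i ∈ F) (i : ι) : x i ∈ F := by
  classical
  rw [← Finset.add_sum_erase _ _ (Finset.mem_univ i)] at h
  exact hF.left_mem_of_add_mem (hx i) (sum_mem fun j _ => hx j) h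

theorem IsFace.sum_mem {Y : Type*} [NormedAddCommGroup Y] [InnerProductSpace ℝ Y]
    {K : ProperCone ℝ Y} {F : Set Y} (hF : IsFace F (K : Set Y)) {ι : Type*} (s : Finset ι)
    {x : ι → Y} (hx : ∀ i, x i ∈ F) : ∑ i ∈ s, x i ∈ F := by
  classical
  induction s using Finset.induction_on with
  | empty => simpa using hF.zero_mem
  | insert i s hi ih =>
    rw [Finset.sum_insert hi]
    exact hF.add_mem (hx i) ih

/-- The span of the vectors `z` with `z zᵀ ∈ E`. -/
def rankOneSpan (E : Set (SymMat n)) : Submodule ℝ (Fin n → ℝ) :=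
  Submodule.span ℝ {z | rankOne z ∈ E}

theorem rankOne_smul (c : ℝ) (z : Fin n → ℝ) : rankOne (c • z) = (c * c) • rankOne z := by
  refine toMat_injective ?_
  rw [map_smul, toMat_rankOne, toMat_rankOne]
  ext i j
  simp [vecMulVec_apply]
  ring

theorem rankOne_add_add_rankOne_sub (z w : Fin n → ℝ) :
    rankOne (z + w) + rankOne (z - w) = (2 : ℝ) • (rankOne z + rankOne w) := by
  refine toMat_injective ?_
  rw [map_add, map_smul, map_add, toMat_rankOne, toMat_rankOne, toMat_rankOne, toMat_rankOne]
  ext i j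
  simp [vecMulVec_apply]
  ring

/-- The vectors `z` with `z zᵀ ∈ E` already form a subspace: by the parallelogram identity, the
matrix of `z + w` is a summand of an element of `E`. -/
theorem mem_rankOneSpan (hE : IsFace E (psdCone n : Set (SymMat n))) {z : Fin n → ℝ} :
    z ∈ rankOneSpan E ↔ rankOne z ∈ E := by
  refine ⟨fun h => ?_, fun h => Submodule.subset_span h⟩
  induction h using Submodule.span_induction with
  | mem z hz => exact hz
  | zero =>
    have : rankOne (0 : Fin n → ℝ) = 0 := by simpa using rankOne_smul 0 (0 : Fin n → ℝ)
    rw [this]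
    exact hE.zero_mem
  | add z w _ _ hz hw =>
    refine hE.left_mem_of_add_mem (rankOne_mem_psdCone _) (rankOne_mem_psdCone (z - w)) ?_
    rw [rankOne_add_add_rankOne_sub]
    exact hE.smul_mem (hE.add_mem hz hw) (by norm_num)
  | smul c z _ hz =>
    rw [rankOne_smul]
    exact hE.smul_mem hz (mul_self_nonneg c)

theorem IsFace.exists_eq_sum_rankOne (hE : IsFace E (psdCone n : Set (SymMat n))) {x : SymMat n}
    (hx : x ∈ E) : ∃ (m : ℕ) (z : Fin m → Fin n → ℝ),
      (∀ j, rankOne (z j) ∈ E) ∧ x = ∑ j, rankOne (z j) := by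
  obtain ⟨m, z, rfl⟩ := ExtendedDual.exists_eq_sum_rankOne (hE.subset hx)
  exact ⟨m, z, hE.mem_of_sum_mem (fun j => rankOne_mem_psdCone _) hx, rfl⟩

theorem subset_of_rankOneSpan_le (hE : IsFace E (psdCone n : Set (SymMat n)))
    (hE' : IsFace E' (psdCone n : Set (SymMat n))) (h : rankOneSpan E ≤ rankOneSpan E') :
    E ⊆ E' := by
  intro x hx
  obtain ⟨m, z, hz, rfl⟩ := hE.exists_eq_sum_rankOne hx
  exact hE'.sum_mem _ fun j => (mem_rankOneSpan hE').1 (h ((mem_rankOneSpan hE).2 (hz j)))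

/-- Along a chain, `rankOneSpan` is monotone and determines the face, so its dimension takes
distinct values in `0, …, n`. -/
theorem faceChainLength_psdCone_le (n : ℕ) : faceChainLength (psdCone n) ≤ n + 1 := by
  refine iSup_le ?_
  rintro ⟨t, ht, hchain⟩
  let r : Set (SymMat n) → ℕ := fun E => Module.finrank ℝ (rankOneSpan E)
  have hinj : Set.InjOn r t := by
    have key : ∀ E ∈ t, ∀ E' ∈ t, E ⊆ E' → r E = r E' → E = E' := by
      intro E hE E' hE' hsub hr
      refine subset_antisymm hsub (subset_of_rankOneSpan_le (ht hE') (ht hE) ?_)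
      have hle : rankOneSpan E ≤ rankOneSpan E' := Submodule.span_mono fun z hz => hsub hz
      exact (Submodule.eq_of_le_of_finrank_eq hle hr).ge
    intro E hE E' hE' hr
    rcases hchain.total hE hE' with h | h
    · exact key E hE E' hE' h hr
    · exact (key E' hE' E hE h hr.symm).symm
  have hmaps : Set.MapsTo r t (Finset.range (n + 1) : Set ℕ) := by
    intro E _
    rw [Finset.mem_coe, Finset.mem_range, Nat.lt_succ_iff]
    simpa using Submodule.finrank_le (rankOneSpan E)
  have h := Set.encard_le_encard_of_injOn hmaps hinj
  rw [Set.encard_coe_eq_coe_finsetCard, Finset.card_range] at h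
  exact_mod_cast h

theorem isNice_psdCone (n : ℕ) : IsNice (psdCone n) := by
  intro E hE
  have heq : (ProperCone.innerDual (psdCone n : Set (SymMat n)) : Set (SymMat n)) +
      (perp E : Set (SymMat n)) = (ProperCone.innerDual E : Set (SymMat n)) := by
    rw [innerDual_psdCone]
    ext y
    constructor
    · rintro ⟨u, hu, v, hv, rfl⟩
      refine ProperCone.mem_innerDual.2 fun x hx => ?_
      rw [inner_add_right, mem_perp.1 hv x hx, add_zero]
      rw [← innerDual_psdCone] at hu
      exact ProperCone.mem_innerDual.1 hu (hE.subset hx)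
    · intro hy
      -- With `Q` a projection onto `rankOneSpan E`, the compression `Qᵀ y Q` is positive
      -- semidefinite for `y ∈ E*` and agrees with `y` on `E`. Hence the sum is the closed cone
      -- `E*`.
      obtain ⟨f, hf⟩ := LinearMap.exists_leftInverse_of_injective (rankOneSpan E).subtype
        (Submodule.ker_subtype _)
      let Q : Matrix (Fin n) (Fin n) ℝ := LinearMap.toMatrix' ((rankOneSpan E).subtype ∘ₗ f)
      have hQ : ∀ z, Q *ᵥ z = (f z : Fin n → ℝ) := fun z => by
        rw [LinearMap.toMatrix'_mulVec]
        rfl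
      have hQ' : ∀ z ∈ rankOneSpan E, Q *ᵥ z = z := fun z hz => by
        rw [hQ]
        exact congrArg Subtype.val (LinearMap.congr_fun hf ⟨z, hz⟩)
      have hsymm : (Qᵀ * toMat y * Q).IsSymm := by
        rw [IsSymm, transpose_mul, transpose_mul, transpose_transpose, (toMat_isSymm y).eq,
          Matrix.mul_assoc]
      have hquad : ∀ z, inner ℝ (rankOne z) (symPart (Qᵀ * toMat y * Q)) =
          inner ℝ (rankOne (Q *ᵥ z)) y := fun z => by
        rw [inner_rankOne, inner_rankOne, toMat_symPart hsymm, dotProduct_congruence]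
      refine ⟨symPart (Qᵀ * toMat y * Q), ?_, y - symPart (Qᵀ * toMat y * Q), ?_, by simp⟩
      · refine mem_psdCone_iff_inner.2 fun z => ?_
        rw [hquad]
        refine ProperCone.mem_innerDual.1 hy ((mem_rankOneSpan hE).1 ?_)
        rw [hQ]
        exact (f z).2
      · refine mem_perp.2 fun x hx => ?_
        obtain ⟨m, z, hz, rfl⟩ := hE.exists_eq_sum_rankOne hx
        rw [sum_inner]
        refine Finset.sum_eq_zero fun j _ => ?_
        rw [inner_sub_right, hquad, hQ' _ ((mem_rankOneSpan hE).2 (hz j)), sub_self]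
  rw [heq]
  exact (ProperCone.innerDual E).isClosed

end Faces

/-! ### Semidefinite representation of the tangent space -/

section Tangent

theorem exists_generalized_inverse {m : ℕ} (B : Matrix (Fin m) (Fin n) ℝ) :
    ∃ H : Matrix (Fin n) (Fin m) ℝ, B * H * B = B := by
  obtain ⟨g, hg⟩ := LinearMap.exists_rightInverse_of_surjective (Matrix.toLin' B).rangeRestrict
    (LinearMap.range_rangeRestrict _)
  obtain ⟨g', hg'⟩ := LinearMap.exists_extend g
  refine ⟨LinearMap.toMatrix' g', ?_⟩
  apply Matrix.toLin'.injective
  rw [Matrix.toLin'_mul, Matrix.toLin'_mul, Matrix.toLin'_toMatrix']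
  refine LinearMap.ext fun z => ?_
  have h1 := LinearMap.congr_fun hg' ((Matrix.toLin' B).rangeRestrict z)
  have h2 := congrArg Subtype.val (LinearMap.congr_fun hg ((Matrix.toLin' B).rangeRestrict z))
  exact (congrArg (Matrix.toLin' B) h1).trans h2

theorem dotProduct_fromBlocks_mulVec (U w D : Matrix (Fin n) (Fin n) ℝ) (x y : Fin n → ℝ) :
    Sum.elim x y ⬝ᵥ fromBlocks U w wᵀ D *ᵥ Sum.elim x y =
      x ⬝ᵥ U *ᵥ x + 2 * (wᵀ *ᵥ x ⬝ᵥ y) + y ⬝ᵥ D *ᵥ y := by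
  have h1 : x ⬝ᵥ w *ᵥ y = wᵀ *ᵥ x ⬝ᵥ y := by rw [dotProduct_mulVec, mulVec_transpose]
  have h2 : y ⬝ᵥ wᵀ *ᵥ x = wᵀ *ᵥ x ⬝ᵥ y := dotProduct_comm _ _
  rw [fromBlocks_mulVec, sumElim_dotProduct_sumElim, Sum.elim_comp_inl, Sum.elim_comp_inr,
    dotProduct_add, dotProduct_add, h1, h2]
  ring

theorem transpose_mulVec_eq_zero_of_block {U w : Matrix (Fin n) (Fin n) ℝ} {β : ℝ}
    (h : (fromBlocks U w wᵀ (β • (1 : Matrix (Fin n) (Fin n) ℝ))).PosSemidef) {z : Fin n → ℝ}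
    (hz : z ⬝ᵥ U *ᵥ z = 0) : wᵀ *ᵥ z = 0 := by
  have hβ : 0 < |β| + 1 := by positivity
  -- The second block is a small negative multiple of `wᵀ z`. The factor `(|β| + 1)⁻¹` makes the
  -- negative cross term outweigh the quadratic term in `β`.
  have h1 := (posSemidef_iff_dotProduct.1 h).2 (Sum.elim z (-(|β| + 1)⁻¹ • (wᵀ *ᵥ z)))
  rw [dotProduct_fromBlocks_mulVec, hz, smul_mulVec, one_mulVec, dotProduct_smul, dotProduct_smul,
    dotProduct_smul, smul_dotProduct] at h1
  simp only [smul_eq_mul] at h1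
  set a := wᵀ *ᵥ z ⬝ᵥ wᵀ *ᵥ z with ha
  have ha0 : 0 ≤ a := by
    rw [ha]
    exact Finset.sum_nonneg fun i _ => mul_self_nonneg _
  refine dotProduct_self_eq_zero.1 (le_antisymm ?_ ha0)
  have h2 : 0 ≤ (|β| + 1) ^ 2 * (0 + 2 * (-(|β| + 1)⁻¹ * a) +
      β * (-(|β| + 1)⁻¹ * (-(|β| + 1)⁻¹ * a))) := mul_nonneg (by positivity) h1
  have e : (|β| + 1) ^ 2 * (0 + 2 * (-(|β| + 1)⁻¹ * a) +
      β * (-(|β| + 1)⁻¹ * (-(|β| + 1)⁻¹ * a))) = -(2 * (|β| + 1) - β) * a := by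
    field_simp
    ring
  rw [e] at h2
  by_contra! hpos
  have : 0 < (2 * (|β| + 1) - β) * a := mul_pos (by linarith [le_abs_self β, abs_nonneg β]) hpos
  linarith

theorem dotProduct_mulVec_self_le {m : ℕ} (C : Matrix (Fin m) (Fin n) ℝ) (y : Fin n → ℝ) :
    C *ᵥ y ⬝ᵥ C *ᵥ y ≤ (∑ i, ∑ j, C i j ^ 2) * (y ⬝ᵥ y) := by
  rw [Finset.sum_mul]
  refine Finset.sum_le_sum fun i _ => ?_
  have := Finset.sum_mul_sq_le_sq_mul_sq Finset.univ (fun j => C i j) y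
  simpa only [dotProduct, mulVec, sq] using this

theorem eq_zero_of_dotProduct_mulVec_eq_zero {M : Matrix (Fin n) (Fin n) ℝ} (hM : M.IsSymm)
    (h : ∀ z, z ⬝ᵥ M *ᵥ z = 0) : M = 0 := by
  have hpsd : M.PosSemidef := posSemidef_iff_dotProduct.2 ⟨hM, fun z => (h z).ge⟩
  refine hpsd.trace_eq_zero_iff.1 (Finset.sum_eq_zero fun i _ => ?_)
  simpa using h (Pi.single i 1)

/-- The tangent space of the positive semidefinite cone is semidefinite representable. -/
theorem mem_perp_exposedFace_psdCone {u : SymMat n} (hu : u ∈ psdCone n) {v : SymMat n} :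
    v ∈ perp (exposedFace (psdCone n) u) ↔ ∃ (w : Matrix (Fin n) (Fin n) ℝ) (β : ℝ),
      (fromBlocks (toMat u) w wᵀ (β • (1 : Matrix (Fin n) (Fin n) ℝ))).PosSemidef ∧
        toMat v = w + wᵀ := by
  constructor
  · intro hv
    obtain ⟨m, B, hB⟩ : ∃ (m : ℕ) (B : Matrix (Fin m) (Fin n) ℝ), toMat u = Bᵀ * B := by
      obtain ⟨m, z, rfl⟩ := exists_eq_sum_rankOne hu
      refine ⟨m, Matrix.of z, ?_⟩
      ext i j
      rw [map_sum, Matrix.sum_apply, mul_apply]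
      refine Finset.sum_congr rfl fun k _ => ?_
      rw [toMat_rankOne]
      rfl
    have hquad : ∀ x, x ⬝ᵥ toMat u *ᵥ x = B *ᵥ x ⬝ᵥ B *ᵥ x := fun x => by
      rw [hB, ← mulVec_mulVec, dotProduct_mulVec, vecMul_transpose]
    obtain ⟨H, hH⟩ := exists_generalized_inverse B
    set V := toMat v with hV
    have hVs : Vᵀ = V := toMat_isSymm v
    -- `Q = 1 - P` maps into the kernel of `B`, which is where the form of `u = Bᵀ B` vanishes. So
    -- tangency forces `Qᵀ V Q = 0`, and `V` is left with its three blocks that involve `P`.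
    let P : Matrix (Fin n) (Fin n) ℝ := H * B
    let Q : Matrix (Fin n) (Fin n) ℝ := 1 - P
    have hBQ : B * Q = 0 := by
      simp only [Q, P]
      rw [Matrix.mul_sub, Matrix.mul_one, ← Matrix.mul_assoc, hH, sub_self]
    have hQVQ : Qᵀ * V * Q = 0 := by
      refine eq_zero_of_dotProduct_mulVec_eq_zero ?_ fun z => ?_
      · rw [IsSymm, transpose_mul, transpose_mul, transpose_transpose, hVs, Matrix.mul_assoc]
      · have hmem : rankOne (Q *ᵥ z) ∈ exposedFace (psdCone n) u := by
          refine ⟨rankOne_mem_psdCone _, ?_⟩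
          rw [inner_rankOne, hquad, mulVec_mulVec, hBQ, zero_mulVec, dotProduct_zero]
        have := mem_perp.1 hv _ hmem
        rwa [inner_rankOne, dotProduct_congruence] at this
    -- The matrix `w = Bᵀ C` takes half of the diagonal block and one off-diagonal block, so `w + wᵀ
    -- = V`. The block form is `|Bx + Cy|² + β|y|² - |Cy|²`, which is nonnegative for `β` the
    -- squared Frobenius norm of `C`.
    let C : Matrix (Fin m) (Fin n) ℝ := Hᵀ * ((1 / 2 : ℝ) • (V * P) + V * Q)
    have hw : Bᵀ * C = (1 / 2 : ℝ) • (Pᵀ * V * P) + Pᵀ * V * Q := by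
      simp only [C]
      rw [← Matrix.mul_assoc, ← transpose_mul, Matrix.mul_add, Matrix.mul_smul, Matrix.mul_assoc,
        Matrix.mul_assoc]
    have hw' : (Bᵀ * C)ᵀ = (1 / 2 : ℝ) • (Pᵀ * V * P) + Qᵀ * V * P := by
      rw [hw]
      simp only [transpose_add, transpose_smul, transpose_mul, transpose_transpose, hVs,
        Matrix.mul_assoc]
    refine ⟨Bᵀ * C, ∑ i, ∑ j, C i j ^ 2, posSemidef_iff_dotProduct.2 ⟨?_, fun x => ?_⟩, ?_⟩
    · rw [IsSymm, fromBlocks_transpose, transpose_transpose, (toMat_isSymm u).eq, transpose_smul,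
        transpose_one]
    · obtain ⟨x, y, rfl⟩ : ∃ x₁ x₂, x = Sum.elim x₁ x₂ :=
        ⟨x ∘ Sum.inl, x ∘ Sum.inr, (Sum.elim_comp_inl_inr x).symm⟩
      rw [dotProduct_fromBlocks_mulVec, hquad, smul_mulVec, one_mulVec, dotProduct_smul,
        smul_eq_mul]
      have h1 := dotProduct_mulVec_self_le C y
      have h2 : (Bᵀ * C)ᵀ *ᵥ x ⬝ᵥ y = B *ᵥ x ⬝ᵥ C *ᵥ y := by
        rw [transpose_mul, transpose_transpose, ← mulVec_mulVec, mulVec_transpose,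
          ← dotProduct_mulVec]
      have h3 : 0 ≤ (B *ᵥ x + C *ᵥ y) ⬝ᵥ (B *ᵥ x + C *ᵥ y) :=
        Finset.sum_nonneg fun i _ => mul_self_nonneg _
      rw [add_dotProduct, dotProduct_add, dotProduct_add, dotProduct_comm (C *ᵥ y) (B *ᵥ x)] at h3
      rw [h2]
      linarith
    · have hPQ : P + Q = 1 := by simp [Q]
      rw [hw', hw]
      calc V = (P + Q)ᵀ * V * (P + Q) := by
            rw [hPQ, transpose_one, Matrix.one_mul, Matrix.mul_one]
        _ = Pᵀ * V * P + Pᵀ * V * Q + Qᵀ * V * P + Qᵀ * V * Q := by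
            rw [transpose_add]
            noncomm_ring
        _ = _ := by
            rw [hQVQ]
            module
  · rintro ⟨w, β, h, hv⟩
    refine mem_perp.2 fun x hx => ?_
    obtain ⟨m, z, hz, rfl⟩ := (isFace_exposedFace
      (by rwa [innerDual_psdCone])).exists_eq_sum_rankOne hx
    rw [sum_inner]
    refine Finset.sum_eq_zero fun j _ => ?_
    have h0 := (hz j).2
    rw [inner_rankOne] at h0 ⊢
    have hw := transpose_mulVec_eq_zero_of_block h h0
    rw [hv, add_mulVec, hw, add_zero, dotProduct_mulVec, ← mulVec_transpose, hw, zero_dotProduct]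

end Tangent
end SymmetricMatrices

/-! ### Translation of semidefinite programs into the conic setting -/

section SemidefiniteProgram

open Matrix

variable {m n : ℕ} {a : Fin m → Matrix (Fin n) (Fin n) ℝ} {b : Matrix (Fin n) (Fin n) ℝ}

/-- The linear operator `x ↦ ∑ x_k a_k` of a semidefinite program. -/
def sdpMap (a : Fin m → Matrix (Fin n) (Fin n) ℝ) : EuclideanSpace ℝ (Fin m) →ₗ[ℝ] SymMat n where
  toFun x := ∑ k, x k • symPart (a k)
  map_add' x y := by simp [add_smul, Finset.sum_add_distrib]
  map_smul' c x := by simp [mul_smul, Finset.smul_sum]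

theorem toMat_sdpMap (ha : ∀ k, (a k).IsSymm) (x : EuclideanSpace ℝ (Fin m)) :
    toMat (sdpMap a x) = ∑ k, x k • a k := by
  change toMat (∑ k, x k • symPart (a k)) = _
  rw [map_sum]
  exact Finset.sum_congr rfl fun k _ => by rw [map_smul, toMat_symPart (ha k)]

theorem mem_feas_sdp (ha : ∀ k, (a k).IsSymm) (hb : b.IsSymm) (x : EuclideanSpace ℝ (Fin m)) :
    x ∈ feas (sdpMap a) (symPart b) (psdCone n) ↔ x.ofLp ∈ sdpFeas a b := by
  change symPart b - sdpMap a x ∈ psdCone n ↔ (b - ∑ k, x k • a k).PosSemidef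
  rw [mem_psdCone, map_sub, toMat_sdpMap ha, toMat_symPart hb]

theorem primalValues_sdp (ha : ∀ k, (a k).IsSymm) (hb : b.IsSymm) (c : Fin m → ℝ) :
    primalValues (sdpMap a) (symPart b) (psdCone n) (WithLp.toLp 2 c) = sdpPrimalValues a b c := by
  have hinner : ∀ x : EuclideanSpace ℝ (Fin m),
      inner ℝ (WithLp.toLp 2 c) x = ∑ k, c k * x k := fun x => by
    simp [PiLp.inner_apply, mul_comm]
  ext r
  constructor
  · rintro ⟨x, hx, rfl⟩
    exact ⟨x.ofLp, (mem_feas_sdp ha hb x).1 hx, hinner x⟩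
  · rintro ⟨x, hx, rfl⟩
    exact ⟨WithLp.toLp 2 x, (mem_feas_sdp ha hb _).2 hx, (hinner _).symm⟩

theorem adjoint_sdpMap_eq_iff (ha : ∀ k, (a k).IsSymm) (y : SymMat n) (c : Fin m → ℝ) :
    LinearMap.adjoint (sdpMap a) y = WithLp.toLp 2 c ↔ ∀ k, matInner (a k) (toMat y) = c k := by
  classical
  have h : ∀ k, LinearMap.adjoint (sdpMap a) y k = matInner (a k) (toMat y) := fun k => by
    have h1 : inner ℝ (EuclideanSpace.single k (1 : ℝ)) (LinearMap.adjoint (sdpMap a) y) =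
        LinearMap.adjoint (sdpMap a) y k := by
      simp [EuclideanSpace.inner_single_left]
    rw [← h1, LinearMap.adjoint_inner_right, inner_eq_matInner, toMat_sdpMap ha]
    congr 1
    rw [Finset.sum_eq_single k]
    · simp
    · intro j _ hj
      simp [hj]
    · simp
  constructor
  · intro e k
    rw [← h, e]
  · intro e
    ext k
    rw [h, e]

theorem mem_nullAdj_sdp (ha : ∀ k, (a k).IsSymm) (hb : b.IsSymm) (y : SymMat n) :
    y ∈ nullAdj (sdpMap a) (symPart b) ↔
      (∀ k, matInner (a k) (toMat y) = 0) ∧ matInner b (toMat y) = 0 := by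
  rw [mem_nullAdj, inner_eq_matInner, toMat_symPart hb]
  exact and_congr_left' (adjoint_sdpMap_eq_iff ha y 0)

theorem mem_tan_psdCone {u v : SymMat n} (hu : u ∈ psdCone n) :
    v ∈ tan u (ProperCone.innerDual (psdCone n : Set (SymMat n)) : Set (SymMat n)) ↔
      ∃ (w : Matrix (Fin n) (Fin n) ℝ) (β : ℝ),
        (fromBlocks (toMat u) w wᵀ (β • (1 : Matrix (Fin n) (Fin n) ℝ))).PosSemidef ∧
          toMat v = w + wᵀ := by
  rw [mem_tan_innerDual (by rwa [innerDual_psdCone]), mem_perp_exposedFace_psdCone hu]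

theorem extDualValues_sdp (ha : ∀ k, (a k).IsSymm) (hb : b.IsSymm) (c : Fin m → ℝ) (l : ℕ) :
    extDualValues (sdpMap a) (symPart b) (psdCone n) (WithLp.toLp 2 c) l =
      sdpExtDualValues a b c l := by
  have hb' := toMat_symPart hb
  ext r
  constructor
  · rintro ⟨u, v, h, hc, rfl⟩
    have hu : ∀ i, u i ∈ psdCone n := by
      intro i
      refine Fin.cases ?_ (fun i => ?_) i
      · rw [h.u_zero]
        exact zero_mem _
      · rw [← innerDual_psdCone]
        exact h.u_mem i
    choose w β hblock hv using fun i => (mem_tan_psdCone (hu _)).1 (h.v_mem i)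
    have hL := fun i => (mem_nullAdj_sdp ha hb _).1 (h.add_mem i)
    refine ⟨fun i => toMat (u i), fun i => toMat (v i), w, β,
      ⟨?_, ?_, ?_, ?_, hblock, hv, ?_, ?_⟩, ?_⟩
    · simpa only [map_add] using (adjoint_sdpMap_eq_iff ha _ c).1 hc
    · simpa only [map_add] using fun i => (hL i).1
    · simpa only [map_add] using fun i => (hL i).2
    · exact fun i => mem_psdCone.1 (hu _)
    · simp only [h.u_zero, map_zero]
    · simp only [h.v_zero, map_zero]
    · rw [inner_eq_matInner, hb', map_add]
  · rintro ⟨u, v, w, β, h, rfl⟩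
    have hu : ∀ i, (u i).PosSemidef := by
      intro i
      refine Fin.cases ?_ (fun i => h.u_psd i) i
      rw [h.u_zero]
      exact PosSemidef.zero
    have hu' : ∀ i, toMat (symPart (u i)) = u i := fun i =>
      toMat_symPart (posSemidef_iff_dotProduct.1 (hu i)).1
    have hv' : ∀ i, toMat (symPart (v i)) = v i := by
      intro i
      refine toMat_symPart ?_
      refine Fin.cases ?_ (fun i => ?_) i
      · rw [h.v_zero]
        exact isSymm_zero
      · rw [h.v_eq, IsSymm, transpose_add, transpose_transpose, add_comm]
    have huK : ∀ i, symPart (u i) ∈ psdCone n := fun i => by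
      rw [mem_psdCone, hu']
      exact hu i
    have hadd : ∀ i, toMat (symPart (u i) + symPart (v i)) = u i + v i := fun i => by
      rw [map_add, hu', hv']
    refine ⟨fun i => symPart (u i), fun i => symPart (v i), ⟨?_, ?_, ?_, ?_, ?_⟩, ?_, ?_⟩
    · exact toMat_injective (by rw [hu', h.u_zero, map_zero])
    · exact toMat_injective (by rw [hv', h.v_zero, map_zero])
    · intro i
      rw [innerDual_psdCone]
      exact huK _
    · intro i
      rw [mem_tan_psdCone (huK _), hu', hv']
      exact ⟨w i, β i, h.block_psd i, h.v_eq i⟩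
    · intro i
      rw [mem_nullAdj_sdp ha hb, hadd]
      exact ⟨h.adj_zero i, h.inner_zero i⟩
    · rw [adjoint_sdpMap_eq_iff ha, hadd]
      exact h.adj_eq
    · rw [inner_eq_matInner, hb', hadd]

theorem sdpMap_injective (ha : ∀ k, (a k).IsSymm) (hli : LinearIndependent ℝ a) :
    Function.Injective (sdpMap a) := by
  refine (injective_iff_map_eq_zero _).2 fun x hx => ?_
  have h := toMat_sdpMap ha x
  rw [hx, map_zero] at h
  ext k
  exact Fintype.linearIndependent_iff.1 hli x.ofLp h.symm k

/-- As `L` is the orthogonal complement of the range of the homogenization, bounding `dim L` amounts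
to bounding that range from below: by `m` in general, by `m + 1` if `b` is outside the span. -/
theorem finrank_nullAdj_add (A : EuclideanSpace ℝ (Fin m) →ₗ[ℝ] SymMat n) (b : SymMat n) :
    Module.finrank ℝ (LinearMap.range (homogenization A b)) +
      Module.finrank ℝ (nullAdj A b) ≤ n * (n + 1) / 2 := by
  rw [nullAdj_eq_orthogonal, Submodule.finrank_add_finrank_orthogonal]
  exact finrank_symMat_le n

theorem le_finrank_range_homogenization (ha : ∀ k, (a k).IsSymm) (hli : LinearIndependent ℝ a)
    (b : SymMat n) : m ≤ Module.finrank ℝ (LinearMap.range (homogenization (sdpMap a) b)) := by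
  have h1 := LinearMap.finrank_range_of_inj (sdpMap_injective ha hli)
  rw [finrank_euclideanSpace_fin] at h1
  refine h1.ge.trans (Submodule.finrank_mono ?_)
  rintro _ ⟨x, rfl⟩
  exact ⟨(0, x), by rw [homogenization_apply, zero_smul, zero_add]⟩

theorem finrank_range_homogenization (ha : ∀ k, (a k).IsSymm) (hb : b.IsSymm)
    (hli : LinearIndependent ℝ a) (hspan : b ∉ Submodule.span ℝ (Set.range a)) :
    Module.finrank ℝ (LinearMap.range (homogenization (sdpMap a) (symPart b))) = 1 + m := by
  have hinj : Function.Injective (homogenization (sdpMap a) (symPart b)) := by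
    refine (injective_iff_map_eq_zero _).2 ?_
    rintro ⟨t, x⟩ h
    rw [homogenization_apply] at h
    have ht : t = 0 := by
      by_contra ht
      refine hspan ?_
      have h' := congrArg toMat h
      rw [map_add, map_smul, toMat_symPart hb, toMat_sdpMap ha, map_zero] at h'
      have e : b = -t⁻¹ • ∑ k, x k • a k := by
        rw [← neg_eq_of_add_eq_zero_right h', smul_neg, smul_smul, neg_mul, inv_mul_cancel₀ ht,
          neg_smul, neg_neg, one_smul]
      rw [e]
      exact Submodule.smul_mem _ _ (Submodule.sum_mem _ fun k _ =>
        Submodule.smul_mem _ _ (Submodule.subset_span ⟨k, rfl⟩))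
    rw [ht, zero_smul, zero_add] at h
    rw [ht, (injective_iff_map_eq_zero _).1 (sdpMap_injective ha hli) x h]
    rfl
  rw [LinearMap.finrank_range_of_inj hinj, Module.finrank_prod, Module.finrank_self,
    finrank_euclideanSpace_fin]

theorem strongDuality_sdp (ha : ∀ k, (a k).IsSymm) (hb : b.IsSymm) (hfeas : (sdpFeas a b).Nonempty)
    {d : ℕ} (hd : Module.finrank ℝ (nullAdj (sdpMap a) (symPart b)) ≤ d) (c : Fin m → ℝ) :
    StrongDuality (sdpPrimalValues a b c) (sdpExtDualValues a b c (min n d)) := by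
  rw [← primalValues_sdp ha hb, ← extDualValues_sdp ha hb]
  obtain ⟨x, hx⟩ := hfeas
  refine strongDuality_extDualValues (isNice_psdCone n)
    ⟨WithLp.toLp 2 x, (mem_feas_sdp ha hb _).2 hx⟩ ?_ _
  rw [(Nat.mono_cast (α := ℕ∞)).map_min]
  refine min_le_min ?_ (Nat.cast_le.2 hd)
  exact tsub_le_iff_right.2 (faceChainLength_psdCone_le n)

end SemidefiniteProgram

end ExtendedDual

end

open ExtendedDual in
theorem corollary2 :
    (∀ (X Y : Type*)
        [NormedAddCommGroup X] [InnerProductSpace ℝ X] [FiniteDimensional ℝ X]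
        [NormedAddCommGroup Y] [InnerProductSpace ℝ Y] [FiniteDimensional ℝ Y]
        (A : X →ₗ[ℝ] Y) (b : Y) (K : ProperCone ℝ Y),
        IsNice K → (feas A b K).Nonempty →
          (∃! F : Set Y, IsMinimalCone A b K F) ∧
          (∀ F : Set Y, IsMinimalCone A b K F →
            (ProperCone.innerDual F : Set Y) =
              {y | ∃ u v : Fin (ell A b K + 2) → Y, ExtNiceSimple A b K (ell A b K) u v ∧
                y = u (Fin.last _) + v (Fin.last _)}) ∧
          (∀ c : X, StrongDuality (primalValues A b K c)
            (extDualValues A b K c (ell A b K)))) ∧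
    (∀ (m n : ℕ) (a : Fin m → Matrix (Fin n) (Fin n) ℝ) (b : Matrix (Fin n) (Fin n) ℝ),
        (∀ k, (a k).IsSymm) → b.IsSymm → LinearIndependent ℝ a →
        (sdpFeas a b).Nonempty →
          (b ∉ Submodule.span ℝ (Set.range a) →
            ∀ c : Fin m → ℝ, StrongDuality (sdpPrimalValues a b c)
              (sdpExtDualValues a b c (min n (n * (n + 1) / 2 - m - 1)))) ∧
          (b ∈ Submodule.span ℝ (Set.range a) →
            ∀ c : Fin m → ℝ, StrongDuality (sdpPrimalValues a b c)
              (sdpExtDualValues a b c (min n (n * (n + 1) / 2 - m))))) := by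
  refine ⟨fun X Y _ _ _ _ _ _ A b K hK hfeas => ⟨existsUnique_isMinimalCone hfeas,
    fun F hF => hF.innerDual_eq hK (ell_spec A b K),
    fun c => strongDuality_extDualValues hK hfeas (ell_spec A b K) c⟩,
    fun m n a b ha hb hli hfeas => ⟨fun hspan c => ?_, fun _ c => ?_⟩⟩
  · refine strongDuality_sdp ha hb hfeas ?_ c
    have h := finrank_nullAdj_add (sdpMap a) (symPart b)
    rw [finrank_range_homogenization ha hb hli hspan] at h
    -- The inequality `h` also gives `m + 1 ≤ n(n+1)/2`, so the truncated subtraction of natural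
    -- numbers is a genuine one.
    omega
  · refine strongDuality_sdp ha hb hfeas ?_ c
    have h := finrank_nullAdj_add (sdpMap a) (symPart b)
    have h' := le_finrank_range_homogenization ha hli (symPart b)
    omega
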